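/- Let $M$ be a closed $C^\infty$ manifold of any dimension $n\ge 0$, let $1\le r\le\infty$, and let $\nu$ be a smooth real line bundle over $M$ with total space $E(\nu)$ and zero section $i:M\to E(\nu)$. A $\Gamma_1^r$-structure $\xi$ on $M$ with normal bundle $\nu$ is a germ along $i(M)$ of a codimension-one foliation of class $C^r$ in $E(\nu)$, transverse to the fibres: it is given on an open neighbourhood $W$ of $i(M)$ by local real $C^r$ functions (distinguished functions), with non-zero derivative along the fibres, any two of which differ near each common point by a $C^r$ diffeomorphism between open subsets of $\mathbb R$. The same definition is used on $M\times[0,1]$. A homotopy from $\xi$ to $\eta$ is a $\Gamma_1^r$-structure on $M\times[0,1]$ whose normal bundle is the pullback of $\nu$ and which induces the germ $\xi$ on $M\times\{0\}$ and the germ $\eta$ on $M\times\{1\}$. For a $C^r$ section $s$ of $\nu$ with values in $W$, $s^*\xi$ denotes the $\Gamma_1^r$-structure with distinguished functions $v\mapsto f(v+s(x))$, $v\in\nu_x$, where $f$ runs over the distinguished functions of $\xi$. A point $x\in M$ is a singularity of $\xi$ if $i$ is not transverse to $\xi$ at $x$. The structure $\xi$ is Morse if, at each singularity $x_0$, the contact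 of $i$ with $\xi$ is quadratic nondegenerate in some foliated chart: there is a function $y$ near $i(x_0)$, equal to a distinguished function composed with a $C^r$ diffeomorphism between open subsets of $\mathbb R$, such that $y\circ i$ is $C^2$ near $x_0$ and has a nondegenerate critical point at $x_0$. Proposition. Let $\xi$ be a $\Gamma_1^r$-structure on $M$ with normal bundle $\nu$, represented by a foliation of an open neighbourhood $W$ of $i(M)$. After a $C^0$-small homotopy, $\xi$ is Morse. That is, for every open neighbourhood $N$ of $i(M)$ in $E(\nu)$ there is a section $s$ of $\nu$ of class $C^r$ such that $t\,s(x)\in N\cap W$ for all $x\in M$ and $t\in[0,1]$, such that the structures $(ts)^*\xi$, $t\in[0,1]$, form a homotopy from $\xi$ to $s^*\xi$, and such that $s^*\xi$ is Morse. -/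

import Mathlib

open Set Filter Topology Bundle
open scoped Manifold ContDiff

/-- Near `p`, the function `f` is obtained from `g` by composing with a `C^r` diffeomorphism between
open subsets of `ℝ`. -/
def GermRelated {X : Type*} [TopologicalSpace X] (r : ℕ∞) (f g : X → ℝ) (p : X) : Prop :=
  ∃ γ : OpenPartialHomeomorph ℝ ℝ, g p ∈ γ.source ∧
    ContDiffOn ℝ r γ γ.source ∧ ContDiffOn ℝ r γ.symm γ.target ∧
    f =ᶠ[𝓝 p] fun q => γ (g q)

theorem GermRelated.comp {X Y : Type*} [TopologicalSpace X] [TopologicalSpace Y] {r : ℕ∞}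
    {f g : X → ℝ} {Φ : Y → X} {q : Y} (h : GermRelated r f g (Φ q)) (hΦ : ContinuousAt Φ q) :
    GermRelated r (f ∘ Φ) (g ∘ Φ) q := by
  obtain ⟨γ, h1, h2, h3, h4⟩ := h
  exact ⟨γ, h1, h2, h3, hΦ.eventually h4⟩

section Structures

variable {EB HB B : Type*} [NormedAddCommGroup EB] [NormedSpace ℝ EB] [TopologicalSpace HB]
  [TopologicalSpace B] [ChartedSpace HB B]

/-- A `Γ_1^r`-structure on the manifold `B` with normal bundle the real line bundle `E`:
a codimension-one foliation of class `C^r` of an open neighbourhood `domain` of the zero section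
in the total space, transverse to the fibres. The foliation is given by an atlas of local defining
functions (distinguished functions) `c.2`, each defined on an open set `c.1`; its leaves are locally
the level sets of these functions. Only the germ of the foliation along the zero section is
significant, see `GammaStructure.GermEq`. -/
structure GammaStructure (I : ModelWithCorners ℝ EB HB) (r : ℕ∞) (E : B → Type*)
    [∀ x, AddCommMonoid (E x)] [∀ x, Module ℝ (E x)] [TopologicalSpace (TotalSpace ℝ E)]
    [∀ x, TopologicalSpace (E x)] [FiberBundle ℝ E] where
  /-- The open neighbourhood of the zero section that is foliated. -/
  domain : Set (TotalSpace ℝ E)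
  isOpen_domain : IsOpen domain
  zero_mem_domain : ∀ x, zeroSection ℝ E x ∈ domain
  /-- The distinguished functions, with their domains of definition. -/
  charts : Set (Set (TotalSpace ℝ E) × (TotalSpace ℝ E → ℝ))
  isOpen_chart : ∀ c ∈ charts, IsOpen c.1
  sUnion_charts : ⋃ c ∈ charts, c.1 = domain
  contMDiffOn_chart : ∀ c ∈ charts, ContMDiffOn (I.prod 𝓘(ℝ, ℝ)) 𝓘(ℝ, ℝ) r c.2 c.1
  /-- Transversality to the fibres: the derivative along the fibre does not vanish. -/
  transverse : ∀ c ∈ charts, ∀ p ∈ c.1, ∀ e : E p.proj, e ≠ 0 →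
    deriv (fun τ : ℝ => c.2 ⟨p.proj, p.2 + τ • e⟩) 0 ≠ 0
  /-- On overlaps two distinguished functions define the same leaves. -/
  compatible : ∀ c ∈ charts, ∀ d ∈ charts, ∀ p ∈ c.1 ∩ d.1, GermRelated r c.2 d.2 p

namespace GammaStructure

variable {I : ModelWithCorners ℝ EB HB} {r : ℕ∞} {E : B → Type*}
    [∀ x, AddCommMonoid (E x)] [∀ x, Module ℝ (E x)] [TopologicalSpace (TotalSpace ℝ E)]
    [∀ x, TopologicalSpace (E x)] [FiberBundle ℝ E]

/-- Two foliations have the same germ along the zero section. -/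
def GermEq (ξ η : GammaStructure I r E) : Prop :=
  ∀ x, ∀ c ∈ ξ.charts, ∀ d ∈ η.charts, zeroSection ℝ E x ∈ c.1 → zeroSection ℝ E x ∈ d.1 →
    GermRelated r c.2 d.2 (zeroSection ℝ E x)

/-- `y` is a transverse coordinate of the foliation near the point `p`: near `p`, it is the
composition of a distinguished function with a `C^r` diffeomorphism between open subsets of `ℝ`.
Thus, for a chart `x` of the base, `(x, y)` is a foliated chart near `p`, with leaves `y = const`
and fibres `x = const`. -/
def IsTransverseCoordinate (ξ : GammaStructure I r E) (y : TotalSpace ℝ E → ℝ)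
    (p : TotalSpace ℝ E) : Prop :=
  ∃ c ∈ ξ.charts, p ∈ c.1 ∧ GermRelated r y c.2 p

/-- `x` is a singularity: the zero section is not transverse at `x` to the foliation, whose tangent
hyperplane is the kernel of the differential of a distinguished function. -/
def IsSingularity (ξ : GammaStructure I r E) (x : B) : Prop :=
  ∃ c ∈ ξ.charts, zeroSection ℝ E x ∈ c.1 ∧
    LinearMap.range
        (mfderiv I (I.prod 𝓘(ℝ, ℝ)) (zeroSection ℝ E) x).toLinearMap ⊔
      LinearMap.ker
        (mfderiv (I.prod 𝓘(ℝ, ℝ)) 𝓘(ℝ, ℝ) c.2 (zeroSection ℝ E x)).toLinearMap ≠ ⊤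

variable {EB' HB' B' : Type*} [NormedAddCommGroup EB'] [NormedSpace ℝ EB'] [TopologicalSpace HB']
  [TopologicalSpace B'] [ChartedSpace HB' B']
  {I' : ModelWithCorners ℝ EB' HB'} {E' : B' → Type*}
    [∀ x, AddCommMonoid (E' x)] [∀ x, Module ℝ (E' x)] [TopologicalSpace (TotalSpace ℝ E')]
    [∀ x, TopologicalSpace (E' x)] [FiberBundle ℝ E']

/-- Pullback of the foliation by a `C^r` map `(b, v) ↦ (φ b, A b v)` of total spaces which is
an injective affine map on every fibre and sends the zero section into the foliated domain. -/
def comap (ξ : GammaStructure I r E) (φ : B' → B) (A : ∀ b, E' b → E (φ b))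
    (hA : ∀ b, ∃ L : E' b →ₗ[ℝ] E (φ b), Function.Injective L ∧ ∀ v e, A b (v + e) = A b v + L e)
    (hΦ : ContMDiff (I'.prod 𝓘(ℝ, ℝ)) (I.prod 𝓘(ℝ, ℝ)) r
      (fun p : TotalSpace ℝ E' => (⟨φ p.proj, A p.proj p.2⟩ : TotalSpace ℝ E)))
    (h0 : ∀ b, (⟨φ b, A b 0⟩ : TotalSpace ℝ E) ∈ ξ.domain) : GammaStructure I' r E' where
  domain := (fun p : TotalSpace ℝ E' => (⟨φ p.proj, A p.proj p.2⟩ : TotalSpace ℝ E)) ⁻¹' ξ.domain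
  isOpen_domain := ξ.isOpen_domain.preimage hΦ.continuous
  zero_mem_domain := h0
  charts := (fun c => ((fun p : TotalSpace ℝ E' =>
      (⟨φ p.proj, A p.proj p.2⟩ : TotalSpace ℝ E)) ⁻¹' c.1,
    c.2 ∘ fun p : TotalSpace ℝ E' => (⟨φ p.proj, A p.proj p.2⟩ : TotalSpace ℝ E))) '' ξ.charts
  isOpen_chart := by
    rintro _ ⟨c, hc, rfl⟩
    exact (ξ.isOpen_chart c hc).preimage hΦ.continuous
  sUnion_charts := by
    rw [← ξ.sUnion_charts, biUnion_image, preimage_iUnion₂]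
  contMDiffOn_chart := by
    rintro _ ⟨c, hc, rfl⟩
    exact (ξ.contMDiffOn_chart c hc).comp hΦ.contMDiffOn fun _ h => h
  transverse := by
    rintro _ ⟨c, hc, rfl⟩ p hp e he
    obtain ⟨L, hL, hAL⟩ := hA p.proj
    have h := ξ.transverse c hc _ hp (L e) (fun h => he (hL (by rw [h, map_zero])))
    simpa [hAL] using h
  compatible := by
    rintro _ ⟨c, hc, rfl⟩ _ ⟨d, hd, rfl⟩ p hp
    have h := ξ.compatible c hc d hd _ hp
    exact h.comp (Φ := fun p : TotalSpace ℝ E' => (⟨φ p.proj, A p.proj p.2⟩ : TotalSpace ℝ E))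
      hΦ.continuous.continuousAt

end GammaStructure

end Structures

section Sections

variable {EB HB B : Type*} [NormedAddCommGroup EB] [NormedSpace ℝ EB] [TopologicalSpace HB]
  [TopologicalSpace B] [ChartedSpace HB B] {I : ModelWithCorners ℝ EB HB} {r : ℕ∞}
  {E : B → Type*}
  [∀ x, AddCommMonoid (E x)] [∀ x, Module ℝ (E x)] [TopologicalSpace (TotalSpace ℝ E)]
  [∀ x, TopologicalSpace (E x)] [FiberBundle ℝ E]

set_option linter.unusedSectionVars false

theorem contMDiff_add_smul_section [VectorBundle ℝ ℝ E] {EX HX X : Type*} [NormedAddCommGroup EX] [NormedSpace ℝ EX]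
    [TopologicalSpace HX] [TopologicalSpace X] [ChartedSpace HX X] {J : ModelWithCorners ℝ EX HX}
    {s : ∀ x, E x}
    (hs : ContMDiff I (I.prod 𝓘(ℝ, ℝ)) r (fun x => (⟨x, s x⟩ : TotalSpace ℝ E)))
    {φ : X → B} {v : ∀ x, E (φ x)} {t : X → ℝ}
    (hv : ContMDiff J (I.prod 𝓘(ℝ, ℝ)) r (fun x => (⟨φ x, v x⟩ : TotalSpace ℝ E)))
    (ht : ContMDiff J 𝓘(ℝ, ℝ) r t) :
    ContMDiff J (I.prod 𝓘(ℝ, ℝ)) r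
      (fun x => (⟨φ x, v x + t x • s (φ x)⟩ : TotalSpace ℝ E)) := by
  intro x₀
  obtain ⟨h1, h2⟩ := contMDiffAt_totalSpace.1 (hv x₀)
  have h3 : ContMDiffAt J (I.prod 𝓘(ℝ, ℝ)) r
      (fun x => (⟨φ x, s (φ x)⟩ : TotalSpace ℝ E)) x₀ :=
    ContMDiffAt.comp x₀ (hs (φ x₀)) h1
  obtain ⟨-, h4⟩ := contMDiffAt_totalSpace.1 h3
  refine contMDiffAt_totalSpace.2 ⟨h1, ?_⟩
  refine (h2.add ((ht x₀).smul h4)).congr_of_eventuallyEq ?_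
  have hb : ∀ᶠ x in 𝓝 x₀, φ x ∈ (trivializationAt ℝ E (φ x₀)).baseSet :=
    h1.continuousAt.eventually
      ((trivializationAt ℝ E (φ x₀)).open_baseSet.mem_nhds (mem_baseSet_trivializationAt ℝ E _))
  filter_upwards [hb] with x hx
  have hl := (trivializationAt ℝ E (φ x₀)).linear ℝ hx
  simp [hl.map_add, hl.map_smul]

/-- The bundle over `B × [0, 1]` pulled back from the bundle `E` over `B`. -/
abbrev CylinderBundle (I : ModelWithCorners ℝ EB HB) (E : B → Type*) :
    B × unitInterval → Type _ :=
  (ContMDiffMap.fst : C^∞⟮I.prod (𝓡∂ 1), B × unitInterval; I, B⟯) *ᵖ E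

theorem contMDiff_cylinder_lift :
    ContMDiff ((I.prod (𝓡∂ 1)).prod 𝓘(ℝ, ℝ)) (I.prod 𝓘(ℝ, ℝ)) r
      (fun p : TotalSpace ℝ (CylinderBundle I E) => (⟨p.proj.1, p.2⟩ : TotalSpace ℝ E)) := by
  intro p₀
  obtain ⟨h1, h2⟩ := contMDiffAt_totalSpace.1
    (contMDiffAt_id (I := (I.prod (𝓡∂ 1)).prod 𝓘(ℝ, ℝ)) (n := (r : WithTop ℕ∞)) (x := p₀))
  exact contMDiffAt_totalSpace.2 ⟨contMDiffAt_fst.comp p₀ h1, h2⟩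

theorem contMDiff_cylinder_incl (t : unitInterval) :
    ContMDiff (I.prod 𝓘(ℝ, ℝ)) ((I.prod (𝓡∂ 1)).prod 𝓘(ℝ, ℝ)) r
      (fun p : TotalSpace ℝ E => (⟨(p.proj, t), p.2⟩ : TotalSpace ℝ (CylinderBundle I E))) := by
  intro p₀
  obtain ⟨h1, h2⟩ := contMDiffAt_totalSpace.1
    (contMDiffAt_id (I := I.prod 𝓘(ℝ, ℝ)) (n := (r : WithTop ℕ∞)) (x := p₀))
  exact contMDiffAt_totalSpace.2 ⟨h1.prodMk contMDiffAt_const, h2⟩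

namespace GammaStructure

/-- The structure on `B` induced on `B × {t}` by a structure on `B × [0, 1]`. -/
noncomputable def atTime (Ξ : GammaStructure (I.prod (𝓡∂ 1)) r (CylinderBundle I E)) (t : unitInterval) :
    GammaStructure I r E :=
  Ξ.comap (fun x => (x, t)) (fun _ v => v)
    (fun x => ⟨(LinearMap.id : E x →ₗ[ℝ] E x), Function.injective_id, fun _ _ => rfl⟩)
    (contMDiff_cylinder_incl t) (fun x => Ξ.zero_mem_domain (x, t))

/-- `Ξ` is a homotopy from `ξ` to `η`: a structure on `B × [0, 1]` that induces the germ `ξ`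
on `B × {0}` and the germ `η` on `B × {1}`. -/
def IsHomotopy (Ξ : GammaStructure (I.prod (𝓡∂ 1)) r (CylinderBundle I E))
    (ξ η : GammaStructure I r E) : Prop :=
  (Ξ.atTime 0).GermEq ξ ∧ (Ξ.atTime 1).GermEq η

/-- The pullback `s^*ξ` by a `C^r` section `s` with values in the foliated domain: the foliation
is translated along the fibres by `-s`, which brings `s` to the zero section. -/
def pullbackSection [VectorBundle ℝ ℝ E] (ξ : GammaStructure I r E) (s : ∀ x, E x)
    (hs : ContMDiff I (I.prod 𝓘(ℝ, ℝ)) r (fun x => (⟨x, s x⟩ : TotalSpace ℝ E)))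
    (hdom : ∀ x, (⟨x, s x⟩ : TotalSpace ℝ E) ∈ ξ.domain) : GammaStructure I r E :=
  ξ.comap id (fun x v => v + s x)
    (fun _ => ⟨LinearMap.id, Function.injective_id, fun _ _ => add_right_comm _ _ _⟩)
    (by
      have h := contMDiff_add_smul_section (φ := fun p : TotalSpace ℝ E => p.proj)
        (v := fun p => p.2) (t := fun _ => (1 : ℝ)) hs contMDiff_id contMDiff_const
      simpa using h)
    (fun x => by simpa using hdom x)

/-- The homotopy defined by a `C^r` section `s`: over `B × {t}` it is the pullback
of `ξ` by the section `t s`. -/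
noncomputable def sectionHomotopy [VectorBundle ℝ ℝ E] (ξ : GammaStructure I r E) (s : ∀ x, E x)
    (hs : ContMDiff I (I.prod 𝓘(ℝ, ℝ)) r (fun x => (⟨x, s x⟩ : TotalSpace ℝ E)))
    (hdom : ∀ x (t : unitInterval), (⟨x, (t : ℝ) • s x⟩ : TotalSpace ℝ E) ∈ ξ.domain) :
    GammaStructure (I.prod (𝓡∂ 1)) r (CylinderBundle I E) :=
  ξ.comap (E' := CylinderBundle I E) (fun b => b.1)
    (fun (b : B × unitInterval) (v : E b.1) => v + (b.2 : ℝ) • s b.1)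
    (fun b => ⟨(LinearMap.id : E b.1 →ₗ[ℝ] E b.1), Function.injective_id,
      fun (_ _ : E b.1) => add_right_comm _ _ _⟩)
    (contMDiff_add_smul_section (φ := fun p : TotalSpace ℝ (CylinderBundle I E) => p.proj.1)
      (v := fun p => p.2) (t := fun p => (p.proj.2 : ℝ)) hs contMDiff_cylinder_lift
      (contMDiff_subtypeVal_Icc.comp (contMDiff_snd.comp (contMDiff_proj _))))
    (fun b => by
      have h : (0 : E b.1) + (b.2 : ℝ) • s b.1 = (b.2 : ℝ) • s b.1 := zero_add _
      exact (congrArg (fun w : E b.1 => (⟨b.1, w⟩ : TotalSpace ℝ E) ∈ ξ.domain) h).mpr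
        (hdom b.1 b.2))

end GammaStructure

end Sections

section Morse

variable {n : ℕ} {M : Type*} [TopologicalSpace M] [ChartedSpace (EuclideanSpace ℝ (Fin n)) M]
  {r : ℕ∞} {ν : M → Type*}
  [∀ x, AddCommMonoid (ν x)] [∀ x, Module ℝ (ν x)] [TopologicalSpace (TotalSpace ℝ ν)]
  [∀ x, TopologicalSpace (ν x)] [FiberBundle ℝ ν]

namespace GammaStructure

/-- The contact of the zero section with the foliation at `x` is quadratic nondegenerate in some
foliated chart `(x, y)` (with `x` a smooth chart of the base) in which the zero section is `C^2`:
near `x` it is the graph of a `C^2` function `y = g` whose first derivative vanishes at `x` and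
whose second derivative at `x` is a nondegenerate bilinear form. -/
def HasQuadraticContact (ξ : GammaStructure (𝓡 n) r ν) (x : M) : Prop :=
  ∃ y : TotalSpace ℝ ν → ℝ, ξ.IsTransverseCoordinate y (zeroSection ℝ ν x) ∧
    ContMDiffAt (𝓡 n) 𝓘(ℝ, ℝ) 2 (y ∘ zeroSection ℝ ν) x ∧
    fderiv ℝ (y ∘ zeroSection ℝ ν ∘ (extChartAt (𝓡 n) x).symm) (extChartAt (𝓡 n) x x) = 0 ∧
    ∀ u, (∀ w, fderiv ℝ (fderiv ℝ (y ∘ zeroSection ℝ ν ∘ (extChartAt (𝓡 n) x).symm))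
      (extChartAt (𝓡 n) x x) u w = 0) → u = 0

/-- The structure is Morse. -/
def IsMorse (ξ : GammaStructure (𝓡 n) r ν) : Prop :=
  ∀ x, ξ.IsSingularity x → ξ.HasQuadraticContact x

end GammaStructure

end Morse

/-! In a foliated chart a section `s` is the graph of a `C^r` function `g`, and the singularities of
`s^*ξ` are the critical points of `g`. A function of class `C^1` is `C^1`-close to a smooth Morse
function, so one chart is easy. The difficulty is to glue. For small `r`, a change of distinguished
function need not preserve being `C^2`, so making `g` smooth in one chart can spoil nothing only if
contacts already treated in other charts are left untouched.

What survives every change of distinguished function is the set of contacts, since critical points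
are preserved by `C^1` diffeomorphisms of the target. The induction therefore carries `IsMorseOn`:
each contact over the part already treated is quadratic for some distinguished function and is
isolated among all contacts. Isolation allows a cutoff that vanishes near the old contacts. Where
the cutoff acts on old territory, `dg` is bounded away from zero, so a `C^1`-small change creates no
critical point there.

`exists_small_linear_perturbation_nondegenerate` (Sard) and `exists_local_perturbation` do the
analysis, `GammaStructure.nonempty_foliatedBox` straightens the foliation by the inverse function
theorem, and `GammaStructure.exists_isMorseOn_union` is the inductive step. Compactness leaves
finitely many steps, starting from the zero section. An open set of admissible values keeps the
section inside boxes that are star-shaped along the fibres, so that `t s` stays in `N` and in the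
domain. -/

theorem coe_ne_zero_of_one_le {r : ℕ∞} (hr : 1 ≤ r) : (r : WithTop ℕ∞) ≠ 0 := by
  rintro h
  rw [WithTop.coe_eq_zero] at h
  simp [h] at hr

/-! ### Perturbing a `C^1` function to a Morse function in Euclidean space. -/

section Euclidean

variable {E : Type*} [NormedAddCommGroup E] [NormedSpace ℝ E] [FiniteDimensional ℝ E]

/-- The second derivative of `g` at `x` is a nondegenerate bilinear form. -/
def NondegenerateHessian {E : Type*} [NormedAddCommGroup E] [NormedSpace ℝ E]
    (g : E → ℝ) (x : E) : Prop :=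
  ∀ u, (∀ w, fderiv ℝ (fderiv ℝ g) x u w = 0) → u = 0

theorem exists_contDiff_cutoff {Q W : Set E} (hQ : IsCompact Q) (hW : IsOpen W) (hQW : Q ⊆ W) :
    ∃ χ : E → ℝ, ContDiff ℝ ∞ χ ∧ HasCompactSupport χ ∧ tsupport χ ⊆ W ∧
      ∀ x ∈ Q, χ =ᶠ[𝓝 x] 1 := by
  obtain ⟨L, hL, hQL, hLW⟩ := exists_compact_between hQ hW hQW
  obtain ⟨f, h0, h1, -⟩ := exists_contMDiffMap_zero_one_nhds_of_isClosed (n := ⊤) 𝓘(ℝ, E)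
    (s := (interior L)ᶜ) (t := Q) isOpen_interior.isClosed_compl hQ.isClosed
    (disjoint_left.2 fun x hx hx' => hx (hQL hx'))
  have hs : tsupport f ⊆ L := by
    refine closure_minimal (fun x hx => ?_) hL.isClosed
    by_contra hxL
    exact hx (h0.self_of_nhdsSet x fun h => hxL (interior_subset h))
  exact ⟨f, f.contMDiff.contDiff, hL.of_isClosed_subset (isClosed_tsupport _) hs, hs.trans hLW,
    fun x hx => h1.filter_mono (nhds_le_nhdsSet hx)⟩

open MeasureTheory in
-- Mollification: both `g` and `dg` are uniformly continuous because the support is compact, and the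
-- derivative of the convolution is the average of `dg`.
theorem exists_contDiff_near_of_hasCompactSupport {g : E → ℝ} (hg : ContDiff ℝ 1 g)
    (hs : HasCompactSupport g) {δ : ℝ} (hδ : 0 < δ) :
    ∃ h : E → ℝ, ContDiff ℝ ∞ h ∧ ∀ x, |h x - g x| ≤ δ ∧ ‖fderiv ℝ h x - fderiv ℝ g x‖ ≤ δ := by
  borelize E
  have hdc : Continuous (fderiv ℝ g) := hg.continuous_fderiv (by norm_num)
  have hds : HasCompactSupport (fderiv ℝ g) := hs.fderiv ℝ
  obtain ⟨η₁, hη₁, h₁⟩ := Metric.uniformContinuous_iff.1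
    (hs.uniformContinuous_of_continuous hg.continuous) δ hδ
  obtain ⟨η₂, hη₂, h₂⟩ := Metric.uniformContinuous_iff.1
    (hds.uniformContinuous_of_continuous hdc) δ hδ
  set η := min η₁ η₂
  have hη : 0 < η := lt_min hη₁ hη₂
  let φ : ContDiffBump (0 : E) := ⟨η / 2, η, by positivity, by linarith⟩
  let μ : Measure E := Measure.addHaar
  have hφs : HasCompactSupport (φ.normed μ) := φ.hasCompactSupport_normed
  have hφi : LocallyIntegrable (φ.normed μ) μ := φ.continuous_normed.locallyIntegrable
  refine ⟨convolution (φ.normed μ) g (ContinuousLinearMap.lsmul ℝ ℝ) μ, ?_, fun x => ⟨?_, ?_⟩⟩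
  · exact hφs.contDiff_convolution_left _ φ.contDiff_normed hg.continuous.locallyIntegrable
  · refine ContDiffBump.dist_normed_convolution_le hg.continuous.aestronglyMeasurable
      fun y hy => (h₁ ?_).le
    exact (Metric.mem_ball.1 hy).trans_le (min_le_left _ _)
  · have h := (hs.hasFDerivAt_convolution_right (ContinuousLinearMap.lsmul ℝ ℝ) hφi hg x).fderiv
    have e : (ContinuousLinearMap.lsmul ℝ ℝ : ℝ →L[ℝ] ℝ →L[ℝ] ℝ).precompR E =
        ContinuousLinearMap.lsmul ℝ ℝ := by
      refine ContinuousLinearMap.ext fun c => ContinuousLinearMap.ext fun A => ?_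
      ext v; rfl
    rw [h, e, ← dist_eq_norm]
    refine ContDiffBump.dist_normed_convolution_le hdc.aestronglyMeasurable
      fun y hy => (h₂ ?_).le
    exact (Metric.mem_ball.1 hy).trans_le (min_le_right _ _)

open MeasureTheory in
-- The critical points of `h + a` are the solutions of `dh = -a`, and they are all nondegenerate
-- when `-a` is a regular value of `dh`. By Sard's theorem in equal dimensions, such values occur
-- arbitrarily close to `0`.
theorem exists_small_linear_perturbation_nondegenerate {h : E → ℝ} (hh : ContDiff ℝ ∞ h)
    {ε : ℝ} (hε : 0 < ε) :
    ∃ a : E →L[ℝ] ℝ, ‖a‖ < ε ∧ ∀ x, fderiv ℝ (fun x => h x + a x) x = 0 →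
      NondegenerateHessian (fun x => h x + a x) x := by
  borelize E
  have hfin : Module.finrank ℝ (E →L[ℝ] ℝ) = Module.finrank ℝ E := by
    rw [← (LinearMap.toContinuousLinearMap (𝕜 := ℝ) (E := E) (F' := ℝ)).finrank_eq]
    exact Subspace.dual_finrank_eq
  -- An arbitrary isomorphism of the dual with `E` turns `dh` into a self-map of `E`, for which
  -- determinants and Sard's theorem are available.
  let D : (E →L[ℝ] ℝ) ≃L[ℝ] E := ContinuousLinearEquiv.ofFinrankEq hfin
  let G : E → E := fun x => D (fderiv ℝ h x)
  let G' : E → E →L[ℝ] E := fun x => (D : (E →L[ℝ] ℝ) →L[ℝ] E) ∘L fderiv ℝ (fderiv ℝ h) x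
  have hd1 : ContDiff ℝ 1 (fderiv ℝ h) := hh.fderiv_right (by norm_cast)
  have hd : Differentiable ℝ (fderiv ℝ h) := hd1.differentiable (by norm_num)
  have hG : ∀ x, HasFDerivAt G (G' x) x := fun x =>
    (D : (E →L[ℝ] ℝ) →L[ℝ] E).hasFDerivAt.comp x (hd x).hasFDerivAt
  have h0 : Measure.addHaar (G '' {x | (G' x).det = 0}) = 0 :=
    addHaar_image_eq_zero_of_det_fderivWithin_eq_zero Measure.addHaar
      (fun x _ => (hG x).hasFDerivWithinAt) (fun x hx => hx)
  have ho : IsOpen (D.symm ⁻¹' Metric.ball 0 ε) := Metric.isOpen_ball.preimage D.symm.continuous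
  have hne : ¬ D.symm ⁻¹' Metric.ball 0 ε ⊆ G '' {x | (G' x).det = 0} := fun hsub =>
    (ho.measure_pos Measure.addHaar ⟨0, by simpa using hε⟩).ne' (measure_mono_null hsub h0)
  obtain ⟨b, hb, hbG⟩ := not_subset.1 hne
  refine ⟨-D.symm b, by simpa using hb, fun x hx u hu => ?_⟩
  have hder : fderiv ℝ (fun x => h x + (-D.symm b) x) = fun x => fderiv ℝ h x + -D.symm b := by
    funext x
    exact (((hh.differentiable (by simp)) x).hasFDerivAt.add (-D.symm b).hasFDerivAt).fderiv
  rw [hder] at hx hu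
  have hGx : G x = b := by
    have : fderiv ℝ h x = D.symm b := by simpa using eq_neg_of_add_eq_zero_left hx
    simp [G, this]
  simp only [fderiv_add_const] at hu
  have hu0 : fderiv ℝ (fderiv ℝ h) x u = 0 := ContinuousLinearMap.ext hu
  by_contra hune
  refine hbG ⟨x, ?_, hGx⟩
  by_contra hdet
  refine hune ((LinearMap.equivOfDetNeZero (G' x).toLinearMap hdet).injective ?_)
  simp [LinearMap.equivOfDetNeZero, G', hu0]

theorem exists_contDiff_nondegenerate_near {g : E → ℝ} {U S : Set E} (hU : IsOpen U)
    (hg : ContDiffOn ℝ 1 g U) (hS : IsCompact S) (hSU : S ⊆ U) {δ : ℝ} (hδ : 0 < δ) :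
    ∃ h : E → ℝ, ContDiff ℝ ∞ h ∧
      (∀ x ∈ S, |h x - g x| ≤ δ ∧ ‖fderiv ℝ h x - fderiv ℝ g x‖ ≤ δ) ∧
      ∀ x, fderiv ℝ h x = 0 → NondegenerateHessian h x := by
  obtain ⟨χ, hχ, hχc, hχU, hχ1⟩ := exists_contDiff_cutoff hS hU hSU
  have hg1 : ContDiff ℝ 1 (fun x => χ x * g x) := by
    refine contDiff_iff_contDiffAt.2 fun x => ?_
    by_cases hx : x ∈ U
    · exact (hχ.of_le (by norm_cast)).contDiffAt.mul (hg.contDiffAt (hU.mem_nhds hx))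
    · have : χ =ᶠ[𝓝 x] 0 := notMem_tsupport_iff_eventuallyEq.1 fun h => hx (hχU h)
      refine (contDiffAt_const (c := (0 : ℝ))).congr_of_eventuallyEq ?_
      filter_upwards [this] with y hy
      simp [hy]
  obtain ⟨h₀, hh₀, hh₀g⟩ := exists_contDiff_near_of_hasCompactSupport hg1 hχc.mul_right
    (half_pos hδ)
  obtain ⟨C, hC⟩ := hS.isBounded.exists_norm_le
  -- With `|C| + 1` bounding the norm on `S`, this bound makes both `‖a‖` and `|a x|` at most `δ /
  -- 2`.
  obtain ⟨a, ha, hnd⟩ := exists_small_linear_perturbation_nondegenerate hh₀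
    (ε := δ / 2 / (|C| + 1)) (by positivity)
  refine ⟨_, hh₀.add a.contDiff, fun x hx => ?_, hnd⟩
  have hx1 : (fun x => χ x * g x) =ᶠ[𝓝 x] g := by
    filter_upwards [hχ1 x hx] with y hy
    simp [hy]
  have hgx : χ x * g x = g x := hx1.self_of_nhds
  have h1 := hh₀g x
  rw [hx1.fderiv_eq, hgx] at h1
  have hder : fderiv ℝ (fun x => h₀ x + a x) x = fderiv ℝ h₀ x + a :=
    (((hh₀.differentiable (by simp)) x).hasFDerivAt.add a.hasFDerivAt).fderiv
  have hmul : ‖a‖ * (|C| + 1) < δ / 2 := (lt_div_iff₀ (by positivity)).1 ha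
  have hxC : ‖x‖ ≤ |C| + 1 := (hC x hx).trans ((le_abs_self C).trans (by linarith))
  have hin : |a x| ≤ δ / 2 := (a.le_opNorm x).trans
    ((mul_le_mul_of_nonneg_left hxC (norm_nonneg _)).trans hmul.le)
  constructor
  · calc |h₀ x + a x - g x| = |(h₀ x - g x) + a x| := by ring_nf
      _ ≤ δ / 2 + δ / 2 := (abs_add_le _ _).trans (add_le_add h1.1 hin)
      _ = δ := by ring
  · change ‖fderiv ℝ (fun x => h₀ x + a x) x - _‖ ≤ δ
    rw [hder, add_sub_right_comm]
    have : ‖a‖ ≤ δ / 2 := by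
      nlinarith [norm_nonneg a, abs_nonneg C]
    exact (norm_add_le _ _).trans ((add_le_add h1.2 this).trans_eq (by ring))

/-- The derivative of `dg` at `x` is injective, hence bounded below in finite dimension, so `dg`
takes no value twice near `x` with one occurrence at `x`. -/
theorem NondegenerateHessian.eventually_fderiv_ne_zero {g : E → ℝ} {x : E}
    (hg : ContDiffAt ℝ 2 g x) (h : NondegenerateHessian g x) :
    ∀ᶠ y in 𝓝[≠] x, fderiv ℝ g y ≠ 0 := by
  have hd : HasFDerivAt (fderiv ℝ g) (fderiv ℝ (fderiv ℝ g) x) x :=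
    ((hg.fderiv_right (m := 1) (by norm_num)).differentiableAt (by norm_num)).hasFDerivAt
  refine hd.eventually_ne ?_
  have hk : LinearMap.ker (fderiv ℝ (fderiv ℝ g) x).toLinearMap = ⊥ :=
    LinearMap.ker_eq_bot'.2 fun u hu => h u fun w => by
      have := congrArg (fun L : E →L[ℝ] ℝ => L w) hu
      simpa using this
  obtain ⟨K, -, hK⟩ := LinearMap.exists_antilipschitzWith _ hk
  exact ⟨K, hK⟩

/-- The function is to be made Morse on `K` by a change supported in `U₁`. The set `B` is the part
already treated: its critical points are isolated and must be left alone, because `g` need not be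
`C^2` in this chart. The set `O` encodes the open constraint on the graph. -/
theorem exists_local_perturbation {g : E → ℝ} {U U₁ K B : Set E} {r : ℕ∞} (hr : 1 ≤ r)
    (hU : IsOpen U) (hg : ContDiffOn ℝ r g U) (hK : IsCompact K) (hKU₁ : K ⊆ U₁)
    (hU₁ : IsOpen U₁) (hU₁U : U₁ ⊆ U)
    (hB : IsCompact B) (hBU : B ⊆ U)
    (hiso : ∀ x ∈ B, fderiv ℝ g x = 0 → ∀ᶠ y in 𝓝[≠] x, fderiv ℝ g y ≠ 0)
    {O : Set (E × ℝ)} (hO : IsOpen O) (hgO : ∀ x ∈ U, (x, g x) ∈ O) :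
    ∃ (g' : E → ℝ) (L : Set E), IsCompact L ∧ L ⊆ U₁ ∧ (∀ x ∉ L, g' x = g x) ∧
      ContDiffOn ℝ r g' U ∧ (∀ x ∈ U, (x, g' x) ∈ O) ∧ (∀ x ∈ B ∩ L, fderiv ℝ g' x ≠ 0) ∧
      ∀ x ∈ K, fderiv ℝ g' x = 0 →
        (x ∈ B ∧ x ∉ L) ∨ (ContDiffAt ℝ ∞ g' x ∧ NondegenerateHessian g' x) := by
  have hr1 : (1 : WithTop ℕ∞) ≤ r := by exact_mod_cast hr
  have hg1 : ContDiffOn ℝ 1 g U := hg.of_le hr1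
  have hdc : ContinuousOn (fderiv ℝ g) U := hg1.continuousOn_fderiv_of_isOpen hU le_rfl
  set Z : Set E := {x ∈ B | fderiv ℝ g x = 0}
  have hZc : IsCompact Z := by
    refine hB.of_isClosed_subset ?_ fun x hx => hx.1
    exact (hdc.mono hBU).preimage_isClosed_of_isClosed hB.isClosed isClosed_singleton
  -- Isolation of the old critical points says that `V` is a neighbourhood of `Z`.
  set V : Set E := {x ∈ U | fderiv ℝ g x = 0 → x ∈ Z}
  have hZV : Z ⊆ interior V := fun z hz => by
    rw [mem_interior_iff_mem_nhds]
    filter_upwards [hU.mem_nhds (hBU hz.1), eventually_nhdsWithin_iff.1 (hiso z hz.1 hz.2)]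
      with y hyU hy
    refine ⟨hyU, fun h0 => ?_⟩
    by_cases hyz : y = z
    · rwa [hyz]
    · exact absurd h0 (hy hyz)
  obtain ⟨C₁, hC₁, hZC₁, hC₁V⟩ := exists_compact_between hZc isOpen_interior hZV
  obtain ⟨C₂, hC₂, hC₁C₂, hC₂V⟩ := exists_compact_between hC₁ isOpen_interior hC₁V
  -- The cutoff vanishes on `C₁`, which surrounds the old critical points, and is `1` near the part
  -- of `K` outside `interior C₂`. The transition inside `K` takes place in `C₂ ⊆ V`, where `g` has
  -- no critical point off `Z`.
  obtain ⟨χ, hχ, hχc, hχU, hχ1⟩ := exists_contDiff_cutoff (hK.diff isOpen_interior)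
    (hU₁.sdiff hC₁.isClosed) (fun x (hx : x ∈ K \ interior C₂) =>
      (⟨hKU₁ hx.1, fun h => hx.2 (hC₁C₂ h)⟩ : x ∈ U₁ \ C₁))
  set L := tsupport χ
  have hL : IsCompact L := hχc
  have hLU₁ : L ⊆ U₁ := fun x hx => (hχU hx).1
  have hLU : L ⊆ U := hLU₁.trans hU₁U
  have hLZ : ∀ x ∈ L, x ∉ Z := fun x hx hxZ => (hχU hx).2 (interior_subset (hZC₁ hxZ))
  have hR : IsCompact (L ∩ (B ∪ C₂)) := hL.inter (hB.union hC₂)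
  have hR0 : ∀ x ∈ L ∩ (B ∪ C₂), fderiv ℝ g x ≠ 0 := by
    rintro x ⟨hxL, hx | hx⟩ h0
    · exact hLZ x hxL ⟨hx, h0⟩
    · exact hLZ x hxL ((interior_subset (hC₂V hx)).2 h0)
  obtain ⟨m, hm, hmR⟩ := hR.exists_forall_le' (f := fun x => ‖fderiv ℝ g x‖) (a := 0)
    (hdc.norm.mono (inter_subset_left.trans hLU)) (fun x hx => norm_pos_iff.2 (hR0 x hx))
  obtain ⟨ε, hε, hεO⟩ := (hL.image_of_continuousOn
    (continuousOn_id.prodMk (hg.continuousOn.mono hLU))).exists_cthickening_subset_open hO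
    (by rintro _ ⟨x, hx, rfl⟩; exact hgO x (hLU hx))
  obtain ⟨c₁, hc₁⟩ := hχc.exists_bound_of_continuous hχ.continuous
  obtain ⟨c₂, hc₂⟩ := (hχc.fderiv ℝ).exists_bound_of_continuous
    (hχ.continuous_fderiv (by simp))
  set c := max (max c₁ c₂) 1
  have hc : 0 < c := lt_max_of_lt_right one_pos
  have hχb : ∀ x, |χ x| ≤ c := fun x =>
    (hc₁ x).trans ((le_max_left _ _).trans (le_max_left _ _))
  have hχb' : ∀ x, ‖fderiv ℝ χ x‖ ≤ c := fun x =>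
    (hc₂ x).trans ((le_max_right _ _).trans (le_max_left _ _))
  -- The derivative of `χ (h - g)` has norm at most `2 c δ` on `L`, strictly less than `3 c δ = min
  -- ε m`: it can neither cancel `dg` where `‖dg‖ ≥ m` nor push the graph out of `O`.
  have hδ : 0 < min ε m / (3 * c) := div_pos (lt_min hε hm) (by positivity)
  set δ := min ε m / (3 * c)
  have hcδ : 3 * (c * δ) = min ε m := by
    simp only [δ]; field_simp
  obtain ⟨h, hh, hhg, hnd⟩ := exists_contDiff_nondegenerate_near hU hg1 hL hLU hδ
  set g' : E → ℝ := fun x => g x + χ x * (h x - g x) with hg'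
  have hoff : ∀ x ∉ L, g' x = g x := fun x hx => by simp [hg', image_eq_zero_of_notMem_tsupport hx]
  have hoff' : ∀ x ∉ L, g' =ᶠ[𝓝 x] g := fun x hx => by
    filter_upwards [hL.isClosed.isOpen_compl.mem_nhds hx] with y hy using hoff y hy
  have hdist : ∀ x ∈ L, ‖fderiv ℝ g' x - fderiv ℝ g x‖ < m := fun x hx => by
    have hgx : DifferentiableAt ℝ g x :=
      (hg1.contDiffAt (hU.mem_nhds (hLU hx))).differentiableAt (by norm_num)
    have hder := (hgx.hasFDerivAt.add ((hχ.differentiable (by simp) x).hasFDerivAt.mul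
      ((hh.differentiable (by simp) x).hasFDerivAt.sub hgx.hasFDerivAt))).fderiv
    change fderiv ℝ g' x = _ at hder
    rw [hder, add_sub_cancel_left]
    have h1 : |χ x| * ‖fderiv ℝ h x - fderiv ℝ g x‖ ≤ c * δ :=
      mul_le_mul (hχb x) (hhg x hx).2 (norm_nonneg _) hc.le
    have h2 : |h x - g x| * ‖fderiv ℝ χ x‖ ≤ δ * c :=
      mul_le_mul (hhg x hx).1 (hχb' x) (norm_nonneg _) hδ.le
    have h3 := min_le_right ε m
    refine (norm_add_le _ _).trans_lt ?_
    rw [norm_smul, norm_smul, Real.norm_eq_abs, Real.norm_eq_abs, Pi.sub_apply]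
    nlinarith [mul_pos hc hδ]
  have hLne : ∀ x ∈ L ∩ (B ∪ C₂), fderiv ℝ g' x ≠ 0 := fun x hx h0 => by
    have h1 := hdist x hx.1
    rw [h0, zero_sub, norm_neg] at h1
    exact (hmR x hx).not_gt h1
  refine ⟨g', L, hL, hLU₁, hoff, ?_, fun x hx => ?_, fun x hx => hLne x ⟨hx.2, .inl hx.1⟩,
    fun x hx h0 => ?_⟩
  · have hχr : ContDiff ℝ r χ := hχ.of_le (by exact_mod_cast le_top)
    have hhr : ContDiff ℝ r h := hh.of_le (by exact_mod_cast le_top)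
    exact hg.add (hχr.contDiffOn.mul (hhr.contDiffOn.sub hg))
  · by_cases hxL : x ∈ L
    · refine hεO (Metric.mem_cthickening_of_dist_le _ (x, g x) _ _ (mem_image_of_mem _ hxL) ?_)
      have h1 : |χ x| * |h x - g x| ≤ c * δ :=
        mul_le_mul (hχb x) (hhg x hxL).1 (abs_nonneg _) hc.le
      have h3 := min_le_left ε m
      rw [Prod.dist_eq, dist_self, Real.dist_eq, hg', add_sub_cancel_left, abs_mul]
      exact max_le hε.le (by nlinarith [mul_pos hc hδ])
    · rw [hoff x hxL]; exact hgO x hx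
  -- Inside `C₂` a critical point must avoid the support, so it is an old one; elsewhere in `K` the
  -- new function coincides locally with the Morse function `h`.
  · by_cases hxC : x ∈ interior C₂
    · have hxC' := interior_subset hxC
      have hxL : x ∉ L := fun hxL => hLne x ⟨hxL, .inr hxC'⟩ h0
      rw [(hoff' x hxL).fderiv_eq] at h0
      exact .inl ⟨((interior_subset (hC₂V hxC')).2 h0).1, hxL⟩
    · have he : g' =ᶠ[𝓝 x] h := by
        filter_upwards [hχ1 x ⟨hx, hxC⟩] with y hy
        simp [hg', hy]
      rw [he.fderiv_eq] at h0
      refine .inr ⟨hh.contDiffAt.congr_of_eventuallyEq he, ?_⟩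
      have := hnd x h0
      rwa [NondegenerateHessian, he.fderiv.fderiv_eq]

end Euclidean

/-! ### Bundle coordinates and foliated boxes. -/

section Boxes

variable {n : ℕ} {M : Type*} [TopologicalSpace M] [ChartedSpace (EuclideanSpace ℝ (Fin n)) M]
  {ν : M → Type*} [∀ x, AddCommGroup (ν x)] [∀ x, Module ℝ (ν x)]
  [TopologicalSpace (TotalSpace ℝ ν)] [∀ x, TopologicalSpace (ν x)] [FiberBundle ℝ ν]

/-- The chart of the total space of a line bundle centred at a point of the zero section. -/
noncomputable abbrev totalChart (n : ℕ) {M : Type*} [TopologicalSpace M]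
    [ChartedSpace (EuclideanSpace ℝ (Fin n)) M] (ν : M → Type*) [∀ x, AddCommGroup (ν x)]
    [∀ x, Module ℝ (ν x)] [TopologicalSpace (TotalSpace ℝ ν)] [∀ x, TopologicalSpace (ν x)] [FiberBundle ℝ ν] (x₀ : M) :
    PartialEquiv (TotalSpace ℝ ν) (EuclideanSpace ℝ (Fin n) × ℝ) :=
  extChartAt ((𝓡 n).prod 𝓘(ℝ, ℝ)) (zeroSection ℝ ν x₀)

theorem totalChart_apply (x₀ : M) (p : TotalSpace ℝ ν) :
    totalChart n ν x₀ p = (extChartAt (𝓡 n) x₀ (trivializationAt ℝ ν x₀ p).1,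
      (trivializationAt ℝ ν x₀ p).2) := by
  rw [totalChart, FiberBundle.extChartAt]; rfl

theorem mem_totalChart_source {x₀ : M} {p : TotalSpace ℝ ν} :
    p ∈ (totalChart n ν x₀).source ↔ p.proj ∈ (extChartAt (𝓡 n) x₀).source ∧
      p.proj ∈ (trivializationAt ℝ ν x₀).baseSet := by
  rw [totalChart, FiberBundle.extChartAt, PartialEquiv.trans_source]
  simp only [mem_inter_iff, mem_preimage, PartialEquiv.prod_source, PartialEquiv.refl_source,
    mem_prod, mem_univ, and_true]
  constructor
  · rintro ⟨h1, h2⟩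
    have h1' : p.proj ∈ (trivializationAt ℝ ν x₀).baseSet := (Trivialization.mem_source _).1 h1
    exact ⟨by rwa [← Trivialization.coe_fst' _ h1'], h1'⟩
  · rintro ⟨h1, h2⟩
    refine ⟨(Trivialization.mem_source _).2 h2, ?_⟩
    change (trivializationAt ℝ ν x₀ p).1 ∈ _
    rwa [Trivialization.coe_fst' _ h2]

theorem totalChart_apply_of_mem {x₀ : M} {p : TotalSpace ℝ ν} (hp : p ∈ (totalChart n ν x₀).source) :
    totalChart n ν x₀ p = (extChartAt (𝓡 n) x₀ p.proj, (trivializationAt ℝ ν x₀ p).2) := by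
  rw [totalChart_apply, Trivialization.coe_fst' _ (mem_totalChart_source.1 hp).2]

theorem mem_totalChart_target {x₀ : M} {z : EuclideanSpace ℝ (Fin n) × ℝ} :
    z ∈ (totalChart n ν x₀).target ↔ z.1 ∈ (extChartAt (𝓡 n) x₀).target ∧
      (extChartAt (𝓡 n) x₀).symm z.1 ∈ (trivializationAt ℝ ν x₀).baseSet := by
  rw [totalChart, FiberBundle.extChartAt_target]
  simp

theorem totalChart_symm_apply {x₀ : M} {z : EuclideanSpace ℝ (Fin n) × ℝ}
    (hz : z ∈ (totalChart n ν x₀).target) :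
    (totalChart n ν x₀).symm z = ⟨(extChartAt (𝓡 n) x₀).symm z.1,
      (trivializationAt ℝ ν x₀).symm ((extChartAt (𝓡 n) x₀).symm z.1) z.2⟩ := by
  rw [Trivialization.mk_symm _ (mem_totalChart_target.1 hz).2, totalChart, FiberBundle.extChartAt]
  rfl

variable [VectorBundle ℝ ℝ ν]

theorem totalChart_zeroSection (x₀ : M) :
    totalChart n ν x₀ (zeroSection ℝ ν x₀) = (extChartAt (𝓡 n) x₀ x₀, 0) := by
  rw [totalChart_apply, Trivialization.zeroSection ℝ _ (mem_baseSet_trivializationAt ℝ ν x₀)]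

theorem totalChart_smul {x₀ : M} {p : TotalSpace ℝ ν} (hp : p ∈ (totalChart n ν x₀).source) (t : ℝ) :
    totalChart n ν x₀ ⟨p.proj, t • p.2⟩ = ((totalChart n ν x₀ p).1, t * (totalChart n ν x₀ p).2) := by
  have hp' : (⟨p.proj, t • p.2⟩ : TotalSpace ℝ ν) ∈ (totalChart n ν x₀).source :=
    mem_totalChart_source.2 ⟨(mem_totalChart_source.1 hp).1, (mem_totalChart_source.1 hp).2⟩
  rw [totalChart_apply_of_mem hp, totalChart_apply_of_mem hp']
  have := ((trivializationAt ℝ ν x₀).linear ℝ (mem_totalChart_source.1 hp).2).map_smul t p.2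
  exact Prod.ext rfl this

/-- Linearity of the trivialization on fibres turns the last coordinate direction into an affine
line in the fibre, which is the form in which `transverse` is stated. -/
theorem totalChart_symm_add {x₀ : M} {z : EuclideanSpace ℝ (Fin n) × ℝ}
    (hz : z ∈ (totalChart n ν x₀).target) :
    ∃ e : ν ((totalChart n ν x₀).symm z).proj, e ≠ 0 ∧ ∀ τ : ℝ,
      (totalChart n ν x₀).symm (z.1, z.2 + τ) =
        ⟨((totalChart n ν x₀).symm z).proj, ((totalChart n ν x₀).symm z).2 + τ • e⟩ := by
  have hb := (mem_totalChart_target.1 hz).2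
  have h : ∀ τ : ℝ, (z.1, z.2 + τ) ∈ (totalChart n ν x₀).target := fun τ =>
    mem_totalChart_target.2 ⟨(mem_totalChart_target.1 hz).1, hb⟩
  rw [totalChart_symm_apply hz]
  refine ⟨(trivializationAt ℝ ν x₀).symm ((extChartAt (𝓡 n) x₀).symm z.1) 1, fun h0 => ?_,
    fun τ => ?_⟩
  -- If `e` were zero, a linear map would send `0` to `1`.
  · have h1 := Trivialization.apply_mk_symm (trivializationAt ℝ ν x₀) hb (1 : ℝ)
    have h2 := ((trivializationAt ℝ ν x₀).linear ℝ hb).map_smul 0 0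
    rw [h0] at h1
    rw [zero_smul, h1] at h2
    simp at h2
  · rw [totalChart_symm_apply (h τ), ← Trivialization.coe_symmₗ (R := ℝ) _ hb]
    have : (z.2 + τ : ℝ) = z.2 + τ • (1 : ℝ) := by simp
    simp only
    rw [this, map_add, map_smul]

variable [IsManifold (𝓡 n) ∞ M] [ContMDiffVectorBundle ∞ ℝ ν (𝓡 n)] {r : ℕ∞}

/-- A box around a point of the zero section, contained in `N`, on which a distinguished function
`c.2` and the base coordinates are the components of a `C^r` diffeomorphism. -/
structure FoliatedBox (ξ : GammaStructure (𝓡 n) r ν) (N : Set (TotalSpace ℝ ν)) (x₀ : M) where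
  /-- The distinguished function and its domain. -/
  c : Set (TotalSpace ℝ ν) × (TotalSpace ℝ ν → ℝ)
  c_mem : c ∈ ξ.charts
  /-- The radius of the box. -/
  ρ : ℝ
  ρ_pos : 0 < ρ
  /-- The change from bundle coordinates to foliated coordinates. -/
  Φ : OpenPartialHomeomorph (EuclideanSpace ℝ (Fin n) × ℝ) (EuclideanSpace ℝ (Fin n) × ℝ)
  source_eq : Φ.source = Metric.ball (extChartAt (𝓡 n) x₀ x₀) ρ ×ˢ Metric.ball 0 ρ
  source_subset : Φ.source ⊆ (totalChart n ν x₀).target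
  symm_mem : ∀ z ∈ Φ.source, (totalChart n ν x₀).symm z ∈ N ∩ c.1
  Φ_apply : ∀ z ∈ Φ.source, Φ z = (z.1, c.2 ((totalChart n ν x₀).symm z))
  contDiffOn_symm : ContDiffOn ℝ r Φ.symm Φ.target

/-- Transversality makes the differential of (base coordinates, distinguished function) block
triangular and invertible, so the inverse function theorem applies. -/
theorem GammaStructure.nonempty_foliatedBox (hr : 1 ≤ r) (ξ : GammaStructure (𝓡 n) r ν)
    {N : Set (TotalSpace ℝ ν)} (hN : IsOpen N) (hN0 : ∀ x, zeroSection ℝ ν x ∈ N) (x₀ : M) :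
    Nonempty (FoliatedBox ξ N x₀) := by
  have hr0 := coe_ne_zero_of_one_le hr
  obtain ⟨c, hc, hc0⟩ : ∃ c ∈ ξ.charts, zeroSection ℝ ν x₀ ∈ c.1 := by
    simpa [← ξ.sUnion_charts] using ξ.zero_mem_domain x₀
  set T := totalChart n ν x₀
  set D := T.target ∩ T.symm ⁻¹' (N ∩ c.1)
  have hD : IsOpen D := (continuousOn_extChartAt_symm _).isOpen_inter_preimage
    (isOpen_extChartAt_target _) (hN.inter (ξ.isOpen_chart c hc))
  set z₀ : EuclideanSpace ℝ (Fin n) × ℝ := (extChartAt (𝓡 n) x₀ x₀, 0)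
  have hTz : T (zeroSection ℝ ν x₀) = z₀ := totalChart_zeroSection x₀
  have hzs : zeroSection ℝ ν x₀ ∈ T.source := mem_extChartAt_source _
  have hz₀ : z₀ ∈ D := by
    refine ⟨hTz ▸ T.map_source hzs, ?_⟩
    rw [mem_preimage, ← hTz, T.left_inv hzs]
    exact ⟨hN0 x₀, hc0⟩
  have hf : ContDiffOn ℝ r (c.2 ∘ T.symm) D := by
    rw [← contMDiffOn_iff_contDiffOn]
    refine (ξ.contMDiffOn_chart c hc).comp (t := c.1) ?_ fun z hz => hz.2.2
    exact ((contMDiffOn_extChartAt_symm (n := ∞) _).of_le (by exact_mod_cast le_top)).mono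
      inter_subset_left
  set Ψ : EuclideanSpace ℝ (Fin n) × ℝ → EuclideanSpace ℝ (Fin n) × ℝ :=
    fun z => (z.1, c.2 (T.symm z))
  have hΨD : ContDiffOn ℝ r Ψ D := contDiff_fst.contDiffOn.prodMk hf
  -- Invertibility is needed on all of `D`, not only at the centre, for the inverse to be `C^r` on
  -- the whole target of the box.
  have hder : ∀ z ∈ D, ∃ A : (EuclideanSpace ℝ (Fin n) × ℝ) ≃L[ℝ] (EuclideanSpace ℝ (Fin n) × ℝ),
      HasFDerivAt Ψ (A : _ →L[ℝ] _) z := by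
    intro z hz
    have hfz : HasFDerivAt (c.2 ∘ T.symm) (fderiv ℝ (c.2 ∘ T.symm) z) z :=
      ((hf.contDiffAt (hD.mem_nhds hz)).differentiableAt hr0).hasFDerivAt
    set ℓ := fderiv ℝ (c.2 ∘ T.symm) z
    obtain ⟨e, he, hadd⟩ := totalChart_symm_add hz.1
    have hℓ : ℓ (0, 1) ≠ 0 := by
      have h1 := ξ.transverse c hc _ hz.2.2 e he
      have h2 : HasDerivAt (fun τ : ℝ => ((z.1, z.2 + τ) : EuclideanSpace ℝ (Fin n) × ℝ))
          (0, 1) 0 := (hasDerivAt_const _ _).prodMk ((hasDerivAt_id (0 : ℝ)).const_add _)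
      have h3 : HasFDerivAt (c.2 ∘ T.symm) ℓ (z.1, z.2 + 0) := by simpa using hfz
      have h4 := (h3.comp_hasDerivAt (0 : ℝ) h2).deriv
      have h5 : (c.2 ∘ T.symm) ∘ (fun τ : ℝ => (z.1, z.2 + τ)) =
          fun τ : ℝ => c.2 ⟨(T.symm z).proj, (T.symm z).2 + τ • e⟩ :=
        funext fun τ => congrArg c.2 (hadd τ)
      rw [← h4, h5]
      exact h1
    have hinj : Function.Injective
        ((ContinuousLinearMap.fst ℝ (EuclideanSpace ℝ (Fin n)) ℝ).prod ℓ).toLinearMap := by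
      rw [← LinearMap.ker_eq_bot, LinearMap.ker_eq_bot']
      rintro ⟨a, b⟩ hab
      obtain ⟨ha, hb⟩ := Prod.mk.inj hab
      have ha : a = 0 := ha
      subst ha
      have h5 : ((0, b) : EuclideanSpace ℝ (Fin n) × ℝ) = b • (0, 1) := by simp
      have hb : ℓ (0, b) = 0 := hb
      rw [h5, map_smul, smul_eq_mul] at hb
      rw [(mul_eq_zero.1 hb).resolve_right hℓ]; rfl
    refine ⟨(LinearEquiv.ofInjectiveEndo _ hinj).toContinuousLinearEquiv, ?_⟩
    exact hasFDerivAt_fst.prodMk hfz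
  obtain ⟨A, hA⟩ := hder z₀ hz₀
  have hΨz := hΨD.contDiffAt (hD.mem_nhds hz₀)
  let Θ := hΨz.toOpenPartialHomeomorph Ψ hA hr0
  have hΘ0 : z₀ ∈ Θ.source := hΨz.mem_toOpenPartialHomeomorph_source hA hr0
  obtain ⟨ρ, hρ, hρD⟩ := Metric.isOpen_iff.1 (Θ.open_source.inter hD) z₀ ⟨hΘ0, hz₀⟩
  have hball : Metric.ball z₀ ρ = Metric.ball (extChartAt (𝓡 n) x₀ x₀) ρ ×ˢ Metric.ball 0 ρ :=
    (ball_prod_same _ _ _).symm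
  have hsrc : (Θ.restrOpen (Metric.ball z₀ ρ) Metric.isOpen_ball).source = Metric.ball z₀ ρ := by
    rw [Θ.restrOpen_source]
    exact inter_eq_right.2 fun z hz => (hρD hz).1
  refine ⟨⟨c, hc, ρ, hρ, Θ.restrOpen (Metric.ball z₀ ρ) Metric.isOpen_ball, hsrc.trans hball,
    fun z hz => ?_, fun z hz => ?_, fun z hz => rfl, fun z hz => ?_⟩⟩
  · rw [hsrc] at hz; exact (hρD hz).2.1
  · rw [hsrc] at hz; exact (hρD hz).2.2
  · have hz' := (Θ.restrOpen (Metric.ball z₀ ρ) Metric.isOpen_ball).map_target hz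
    rw [hsrc] at hz'
    obtain ⟨A', hA'⟩ := hder _ (hρD hz').2
    exact (OpenPartialHomeomorph.contDiffAt_symm _ hz hA'
      (hΨD.contDiffAt (hD.mem_nhds (hρD hz').2))).contDiffWithinAt

end Boxes

/-! ### Invariance of critical points and Hessians under smooth changes of base coordinates. -/

theorem NondegenerateHessian.comp {E F : Type*} [NormedAddCommGroup E] [NormedSpace ℝ E]
    [NormedAddCommGroup F] [NormedSpace ℝ F] {g : F → ℝ} {τ : E → F} {y : E}
    (h : NondegenerateHessian g (τ y)) (hg : ContDiffAt ℝ 2 g (τ y)) (hτ : ContDiffAt ℝ 2 τ y)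
    (h0 : fderiv ℝ g (τ y) = 0) (hbij : Function.Bijective (fderiv ℝ τ y)) :
    NondegenerateHessian (g ∘ τ) y := by
  intro u hu
  have hgd : DifferentiableAt ℝ (fderiv ℝ g) (τ y) :=
    (hg.fderiv_right (m := 1) (by norm_num)).differentiableAt (by norm_num)
  have hτd : DifferentiableAt ℝ (fderiv ℝ τ) y :=
    (hτ.fderiv_right (m := 1) (by norm_num)).differentiableAt (by norm_num)
  have hτ1 : DifferentiableAt ℝ τ y := hτ.differentiableAt (by norm_num)
  have he : fderiv ℝ (g ∘ τ) =ᶠ[𝓝 y] fun y' => (fderiv ℝ g (τ y')).comp (fderiv ℝ τ y') := by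
    filter_upwards [hτ.eventually (by simp), hτ.continuousAt.eventually (hg.eventually (by simp))]
      with y' h1 h2
    exact fderiv_comp _ (h2.differentiableAt (by norm_num)) (h1.differentiableAt (by norm_num))
  have hd := (hgd.hasFDerivAt.comp y hτ1.hasFDerivAt).clm_comp hτd.hasFDerivAt
  have hd' : fderiv ℝ (fderiv ℝ (g ∘ τ)) y = _ := he.fderiv_eq.trans hd.fderiv
  refine hbij.1 ((h _ fun w => ?_).trans (map_zero _).symm)
  obtain ⟨w, rfl⟩ := hbij.2 w
  have hw := hu w
  rw [hd'] at hw
  -- The product rule adds a term with the second derivative of `τ`; it vanishes because `τ y` is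
  -- critical for `g`.
  have hw' : fderiv ℝ g (τ y) (fderiv ℝ (fderiv ℝ τ) y u w) +
    fderiv ℝ (fderiv ℝ g) (τ y) (fderiv ℝ τ y u) (fderiv ℝ τ y w) = 0 := hw
  rwa [h0, zero_apply, zero_add] at hw'

section Charts

variable {n : ℕ} {M : Type*} [TopologicalSpace M] [ChartedSpace (EuclideanSpace ℝ (Fin n)) M]
  [IsManifold (𝓡 n) ∞ M]

theorem contMDiffAt_extChartAt_symm_of_mem {x₀ : M} {z : EuclideanSpace ℝ (Fin n)} {r : ℕ∞}
    (hz : z ∈ (extChartAt (𝓡 n) x₀).target) :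
    ContMDiffAt 𝓘(ℝ, EuclideanSpace ℝ (Fin n)) (𝓡 n) r (extChartAt (𝓡 n) x₀).symm z :=
  ((contMDiffOn_extChartAt_symm (n := ∞) x₀).contMDiffAt
    ((isOpen_extChartAt_target x₀).mem_nhds hz)).of_le (by exact_mod_cast le_top)

theorem contMDiffAt_extChartAt_of_mem {x₀ x : M} {r : ℕ∞}
    (hx : x ∈ (extChartAt (𝓡 n) x₀).source) :
    ContMDiffAt (𝓡 n) 𝓘(ℝ, EuclideanSpace ℝ (Fin n)) r (extChartAt (𝓡 n) x₀) x := by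
  rw [extChartAt_source] at hx
  exact (contMDiffAt_extChartAt' (n := ∞) hx).of_le (by exact_mod_cast le_top)

omit [IsManifold (𝓡 n) ∞ M] in
theorem comp_extChartAt_symm_comp_extChartAt_eventuallyEq {Y : Type*} (f : M → Y) {x₀ x : M}
    (hx : x ∈ (extChartAt (𝓡 n) x₀).source) :
    (f ∘ (extChartAt (𝓡 n) x₀).symm) ∘ extChartAt (𝓡 n) x₀ =ᶠ[𝓝 x] f := by
  filter_upwards [(isOpen_extChartAt_source x₀).mem_nhds hx] with y hy
  exact congrArg f ((extChartAt (𝓡 n) x₀).left_inv hy)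

theorem mfderiv_eq_zero_iff_fderiv_comp_symm {f : M → ℝ} {x₀ x : M}
    (hx : x ∈ (extChartAt (𝓡 n) x₀).source) (hf : MDifferentiableAt (𝓡 n) 𝓘(ℝ, ℝ) f x) :
    mfderiv (𝓡 n) 𝓘(ℝ, ℝ) f x = 0 ↔
      fderiv ℝ (f ∘ (extChartAt (𝓡 n) x₀).symm) (extChartAt (𝓡 n) x₀ x) = 0 := by
  have hz := (extChartAt (𝓡 n) x₀).map_source hx
  have hl := (extChartAt (𝓡 n) x₀).left_inv hx
  have h1 := (contMDiffAt_extChartAt_symm_of_mem (r := 1) hz).mdifferentiableAt (by norm_num)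
  have h2 := (contMDiffAt_extChartAt_of_mem (r := 1) hx).mdifferentiableAt (by norm_num)
  have hf' : MDifferentiableAt (𝓡 n) 𝓘(ℝ, ℝ) f
      ((extChartAt (𝓡 n) x₀).symm (extChartAt (𝓡 n) x₀ x)) := by rwa [hl]
  rw [← mfderiv_eq_fderiv]
  constructor
  · intro h
    rw [mfderiv_comp _ hf' h1, hl, h]
    exact ContinuousLinearMap.zero_comp _
  · intro h
    rw [← (comp_extChartAt_symm_comp_extChartAt_eventuallyEq f hx).mfderiv_eq,
      mfderiv_comp _ (hf'.comp _ h1) h2, h]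
    exact ContinuousLinearMap.zero_comp _

theorem NondegenerateHessian.change_chart {f : M → ℝ} {x₀ x : M}
    (hx : x ∈ (extChartAt (𝓡 n) x₀).source) (hf : ContMDiffAt (𝓡 n) 𝓘(ℝ, ℝ) 2 f x)
    (h0 : fderiv ℝ (f ∘ (extChartAt (𝓡 n) x₀).symm) (extChartAt (𝓡 n) x₀ x) = 0)
    (h : NondegenerateHessian (f ∘ (extChartAt (𝓡 n) x₀).symm) (extChartAt (𝓡 n) x₀ x)) :
    NondegenerateHessian (f ∘ (extChartAt (𝓡 n) x).symm) (extChartAt (𝓡 n) x x) := by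
  set φ := extChartAt (𝓡 n) x₀
  set ψ := extChartAt (𝓡 n) x
  have hxψ : x ∈ ψ.source := mem_extChartAt_source x
  have hz := φ.map_source hx
  have hy := ψ.map_source hxψ
  have hlφ := φ.left_inv hx
  have hlψ := ψ.left_inv hxψ
  have hφ := contMDiffAt_extChartAt_of_mem (r := 2) hx
  have hψ := contMDiffAt_extChartAt_of_mem (r := 2) hxψ
  have hφs := contMDiffAt_extChartAt_symm_of_mem (r := 2) hz
  have hψs := contMDiffAt_extChartAt_symm_of_mem (r := 2) hy
  have hτ : ContDiffAt ℝ 2 (φ ∘ ψ.symm) (ψ x) :=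
    (ContMDiffAt.comp (ψ x) (by rw [hlψ]; exact hφ) hψs).contDiffAt
  have hτ' : ContDiffAt ℝ 2 (ψ ∘ φ.symm) (φ x) :=
    (ContMDiffAt.comp (φ x) (by rw [hlφ]; exact hψ) hφs).contDiffAt
  have hg : ContDiffAt ℝ 2 (f ∘ φ.symm) (φ x) :=
    (ContMDiffAt.comp (φ x) (by rw [hlφ]; exact hf) hφs).contDiffAt
  have hτx : (φ ∘ ψ.symm) (ψ x) = φ x := congrArg φ hlψ
  have hsrc : ∀ᶠ y in 𝓝 (ψ x), ψ.symm y ∈ φ.source :=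
    hψs.continuousAt.eventually ((isOpen_extChartAt_source x₀).mem_nhds (by rwa [hlψ]))
  have hid : (ψ ∘ φ.symm) ∘ (φ ∘ ψ.symm) =ᶠ[𝓝 (ψ x)] id := by
    filter_upwards [hsrc, (isOpen_extChartAt_target x).mem_nhds hy] with y h1 h2
    simp [φ.left_inv h1, ψ.right_inv h2]
  have hfe : f ∘ ψ.symm =ᶠ[𝓝 (ψ x)] (f ∘ φ.symm) ∘ (φ ∘ ψ.symm) := by
    filter_upwards [hsrc] with y h1
    simp [φ.left_inv h1]
  -- The chain rule for the two mutually inverse transition maps provides a left inverse of the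
  -- derivative.
  have hinj : Function.Injective (fderiv ℝ (φ ∘ ψ.symm) (ψ x)) := by
    have h1 := fderiv_comp (ψ x) (g := ψ ∘ φ.symm) (f := φ ∘ ψ.symm)
      (by rw [hτx]; exact hτ'.differentiableAt (by norm_num)) (hτ.differentiableAt (by norm_num))
    rw [hid.fderiv_eq, fderiv_id] at h1
    refine Function.LeftInverse.injective (g := fderiv ℝ (ψ ∘ φ.symm) ((φ ∘ ψ.symm) (ψ x)))
      fun v => ?_
    exact (congrArg (fun L : _ →L[ℝ] _ => L v) h1).symm
  have := NondegenerateHessian.comp (τ := φ ∘ ψ.symm) (y := ψ x) (g := f ∘ φ.symm)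
    (by rwa [hτx]) (by rwa [hτx]) hτ (by rwa [hτx])
    ⟨hinj, LinearMap.injective_iff_surjective.1 hinj⟩
  rwa [NondegenerateHessian, hfe.fderiv.fderiv_eq]

end Charts

/-! ### Contacts of a section with the foliation, and their relation to singularities of the
pullback. -/

section Contacts

variable {n : ℕ} {M : Type*} [TopologicalSpace M] [ChartedSpace (EuclideanSpace ℝ (Fin n)) M]
  {ν : M → Type*} [∀ x, AddCommGroup (ν x)] [∀ x, Module ℝ (ν x)]
  [TopologicalSpace (TotalSpace ℝ ν)] [∀ x, TopologicalSpace (ν x)] [FiberBundle ℝ ν]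
  {r : ℕ∞}

namespace GammaStructure

/-- The section `s` is tangent at `x` to the foliation. -/
def IsContact (ξ : GammaStructure (𝓡 n) r ν) (s : ∀ x, ν x) (x : M) : Prop :=
  ∀ c ∈ ξ.charts, (⟨x, s x⟩ : TotalSpace ℝ ν) ∈ c.1 →
    mfderiv (𝓡 n) 𝓘(ℝ, ℝ) (c.2 ∘ fun x => (⟨x, s x⟩ : TotalSpace ℝ ν)) x = 0

/-- The contact of the section `s` with the foliation at `x` is quadratic nondegenerate, as
witnessed by a distinguished function. -/
def IsQuadraticContact (ξ : GammaStructure (𝓡 n) r ν) (s : ∀ x, ν x) (x : M) : Prop :=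
  ∃ c ∈ ξ.charts, (⟨x, s x⟩ : TotalSpace ℝ ν) ∈ c.1 ∧
    ContMDiffAt (𝓡 n) 𝓘(ℝ, ℝ) 2 (c.2 ∘ fun x => (⟨x, s x⟩ : TotalSpace ℝ ν)) x ∧
    fderiv ℝ ((c.2 ∘ fun x => (⟨x, s x⟩ : TotalSpace ℝ ν)) ∘ (extChartAt (𝓡 n) x).symm)
      (extChartAt (𝓡 n) x x) = 0 ∧
    NondegenerateHessian ((c.2 ∘ fun x => (⟨x, s x⟩ : TotalSpace ℝ ν)) ∘
      (extChartAt (𝓡 n) x).symm) (extChartAt (𝓡 n) x x)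

/-- Every contact of `s` with the foliation at a point of `A` is quadratic nondegenerate and
isolated. -/
def IsMorseOn (ξ : GammaStructure (𝓡 n) r ν) (s : ∀ x, ν x) (A : Set M) : Prop :=
  ∀ x ∈ A, ξ.IsContact s x → ξ.IsQuadraticContact s x ∧ ∀ᶠ y in 𝓝[≠] x, ¬ ξ.IsContact s y

variable {ξ : GammaStructure (𝓡 n) r ν}

theorem isContact_congr {s s' : ∀ x, ν x} {x : M} (h : ∀ᶠ y in 𝓝 x, s' y = s y) :
    ξ.IsContact s' x ↔ ξ.IsContact s x := by
  refine forall₂_congr fun c _ => ?_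
  rw [h.self_of_nhds]
  have : (c.2 ∘ fun x => (⟨x, s' x⟩ : TotalSpace ℝ ν)) =ᶠ[𝓝 x]
      (c.2 ∘ fun x => (⟨x, s x⟩ : TotalSpace ℝ ν)) := by
    filter_upwards [h] with y hy
    simp [hy]
  rw [this.mfderiv_eq]
  exact Iff.rfl

theorem IsQuadraticContact.congr {s s' : ∀ x, ν x} {x : M} (h : ∀ᶠ y in 𝓝 x, s' y = s y)
    (hq : ξ.IsQuadraticContact s x) : ξ.IsQuadraticContact s' x := by
  obtain ⟨c, hc, hcx, h1, h2, h3⟩ := hq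
  have he : (c.2 ∘ fun x => (⟨x, s' x⟩ : TotalSpace ℝ ν)) =ᶠ[𝓝 x]
      (c.2 ∘ fun x => (⟨x, s x⟩ : TotalSpace ℝ ν)) := by
    filter_upwards [h] with y hy
    simp [hy]
  have he' : (c.2 ∘ fun x => (⟨x, s' x⟩ : TotalSpace ℝ ν)) ∘ (extChartAt (𝓡 n) x).symm
      =ᶠ[𝓝 (extChartAt (𝓡 n) x x)]
      (c.2 ∘ fun x => (⟨x, s x⟩ : TotalSpace ℝ ν)) ∘ (extChartAt (𝓡 n) x).symm := by
    refine he.comp_tendsto ?_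
    have := continuousAt_extChartAt_symm (I := 𝓡 n) x
    rwa [ContinuousAt, extChartAt_to_inv] at this
  refine ⟨c, hc, ?_, h1.congr_of_eventuallyEq he, ?_, ?_⟩
  · rwa [h.self_of_nhds]
  · rwa [he'.fderiv_eq]
  · rwa [NondegenerateHessian, he'.fderiv.fderiv_eq]

theorem contMDiffAt_chart_comp (ξ : GammaStructure (𝓡 n) r ν) {s : ∀ x, ν x}
    (hs : ContMDiff (𝓡 n) ((𝓡 n).prod 𝓘(ℝ, ℝ)) r (fun x => (⟨x, s x⟩ : TotalSpace ℝ ν)))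
    {c : Set (TotalSpace ℝ ν) × (TotalSpace ℝ ν → ℝ)} (hc : c ∈ ξ.charts) {x : M}
    (hx : (⟨x, s x⟩ : TotalSpace ℝ ν) ∈ c.1) :
    ContMDiffAt (𝓡 n) 𝓘(ℝ, ℝ) r (c.2 ∘ fun x => (⟨x, s x⟩ : TotalSpace ℝ ν)) x :=
  ((ξ.contMDiffOn_chart c hc).contMDiffAt ((ξ.isOpen_chart c hc).mem_nhds hx)).comp x (hs x)

/-- Two distinguished functions differ locally by a differentiable function of one variable, so by
the chain rule the vanishing of the derivative for one of them implies it for all. -/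
theorem isContact_iff (hr : 1 ≤ r) {s : ∀ x, ν x}
    (hs : ContMDiff (𝓡 n) ((𝓡 n).prod 𝓘(ℝ, ℝ)) r (fun x => (⟨x, s x⟩ : TotalSpace ℝ ν)))
    {c : Set (TotalSpace ℝ ν) × (TotalSpace ℝ ν → ℝ)} (hc : c ∈ ξ.charts) {x : M}
    (hx : (⟨x, s x⟩ : TotalSpace ℝ ν) ∈ c.1) :
    ξ.IsContact s x ↔
      mfderiv (𝓡 n) 𝓘(ℝ, ℝ) (c.2 ∘ fun x => (⟨x, s x⟩ : TotalSpace ℝ ν)) x = 0 := by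
  have hr0 := coe_ne_zero_of_one_le hr
  refine ⟨fun h => h c hc hx, fun h d hd hdx => ?_⟩
  obtain ⟨γ, hγ, hγd, -, he⟩ := (ξ.compatible d hd c hc _ ⟨hdx, hx⟩).comp
    (Φ := fun x => (⟨x, s x⟩ : TotalSpace ℝ ν)) (hs.continuous.continuousAt (x := x))
  have h1 : MDifferentiableAt 𝓘(ℝ, ℝ) 𝓘(ℝ, ℝ) γ
      ((c.2 ∘ fun x => (⟨x, s x⟩ : TotalSpace ℝ ν)) x) :=
    ((hγd.contDiffAt (γ.open_source.mem_nhds hγ)).differentiableAt hr0).mdifferentiableAt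
  have h2 := (ξ.contMDiffAt_chart_comp hs hc hx).mdifferentiableAt hr0
  have h3 : mfderiv (𝓡 n) 𝓘(ℝ, ℝ) (d.2 ∘ fun x => (⟨x, s x⟩ : TotalSpace ℝ ν)) x =
      mfderiv (𝓡 n) 𝓘(ℝ, ℝ) (γ ∘ (c.2 ∘ fun x => (⟨x, s x⟩ : TotalSpace ℝ ν))) x :=
    he.mfderiv_eq
  rw [h3, mfderiv_comp _ h1 h2, h]
  exact ContinuousLinearMap.comp_zero _

/-- The kernel of the covector `ℓ` has codimension at most one, so any vector on which `ℓ` is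
nonzero spans a complement of it; failure of transversality forces `ℓ` to vanish on the tangent
space of the zero section. -/
theorem mfderiv_eq_zero_of_isSingularity [VectorBundle ℝ ℝ ν] {η : GammaStructure (𝓡 n) r ν}
    (hr : 1 ≤ r) {x : M} (h : η.IsSingularity x) :
    ∃ c ∈ η.charts, zeroSection ℝ ν x ∈ c.1 ∧
      mfderiv (𝓡 n) 𝓘(ℝ, ℝ) (c.2 ∘ zeroSection ℝ ν) x = 0 := by
  have hr0 := coe_ne_zero_of_one_le hr
  obtain ⟨c, hc, hx, hne⟩ := h
  refine ⟨c, hc, hx, ?_⟩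
  have h1 := ((η.contMDiffOn_chart c hc).contMDiffAt
    ((η.isOpen_chart c hc).mem_nhds hx)).mdifferentiableAt hr0
  have h2 : MDifferentiableAt (𝓡 n) ((𝓡 n).prod 𝓘(ℝ, ℝ)) (zeroSection ℝ ν) x :=
    ((contMDiff_zeroSection ℝ ν (n := (r : WithTop ℕ∞))) x).mdifferentiableAt hr0
  rw [mfderiv_comp _ h1 h2]
  by_contra hne0
  refine hne (eq_top_iff.2 fun v _ => ?_)
  set A := mfderiv (𝓡 n) ((𝓡 n).prod 𝓘(ℝ, ℝ)) (zeroSection ℝ ν) x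
  set ℓ := mfderiv ((𝓡 n).prod 𝓘(ℝ, ℝ)) 𝓘(ℝ, ℝ) c.2 (zeroSection ℝ ν x)
  obtain ⟨w, hw⟩ : ∃ w, ℓ (A w) ≠ 0 := by
    by_contra! hall
    exact hne0 (ContinuousLinearMap.ext hall)
  let ℓv : ℝ := ℓ v
  let ℓw : ℝ := ℓ (A w)
  have hw' : ℓw ≠ 0 := hw
  have hdec : v = (ℓv / ℓw) • A w + (v - (ℓv / ℓw) • A w) := by abel
  rw [hdec]
  refine Submodule.add_mem_sup (Submodule.smul_mem _ _ ⟨w, rfl⟩) ?_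
  change ℓ (v - (ℓv / ℓw) • A w) = 0
  rw [map_sub, map_smul]
  change ℓv - (ℓv / ℓw) * ℓw = 0
  field_simp
  simp

/-- The translation by `s` carries the zero section to `s`, so the distinguished function witnessing
the quadratic contact of `s`, once translated, is itself the required transverse coordinate. -/
theorem isMorse_pullbackSection [VectorBundle ℝ ℝ ν] (hr : 1 ≤ r)
    (ξ : GammaStructure (𝓡 n) r ν) {s : ∀ x, ν x}
    (hs : ContMDiff (𝓡 n) ((𝓡 n).prod 𝓘(ℝ, ℝ)) r (fun x => (⟨x, s x⟩ : TotalSpace ℝ ν)))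
    (hdom : ∀ x, (⟨x, s x⟩ : TotalSpace ℝ ν) ∈ ξ.domain) (h : ξ.IsMorseOn s univ) :
    (ξ.pullbackSection s hs hdom).IsMorse := by
  have hz : ∀ f : TotalSpace ℝ ν → ℝ, (f ∘ fun p : TotalSpace ℝ ν =>
      (⟨p.proj, p.2 + s p.proj⟩ : TotalSpace ℝ ν)) ∘ zeroSection ℝ ν =
      f ∘ fun x => (⟨x, s x⟩ : TotalSpace ℝ ν) := by
    intro f
    funext x
    change f ⟨x, 0 + s x⟩ = _
    rw [zero_add]; rfl
  intro x hx
  obtain ⟨_, ⟨c, hc, rfl⟩, hxc, h0⟩ := mfderiv_eq_zero_of_isSingularity hr hx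
  have hxc' : (⟨x, 0 + s x⟩ : TotalSpace ℝ ν) ∈ c.1 := hxc
  rw [zero_add] at hxc'
  have h0' := h0
  change mfderiv (𝓡 n) 𝓘(ℝ, ℝ) ((c.2 ∘ fun p : TotalSpace ℝ ν =>
      (⟨p.proj, p.2 + s p.proj⟩ : TotalSpace ℝ ν)) ∘ zeroSection ℝ ν) x = 0 at h0'
  rw [hz] at h0'
  obtain ⟨⟨d, hd, hxd, h1, h2, h3⟩, -⟩ := h x (mem_univ x) ((isContact_iff hr hs hc hxc').2 h0')
  refine ⟨d.2 ∘ fun p : TotalSpace ℝ ν => (⟨p.proj, p.2 + s p.proj⟩ : TotalSpace ℝ ν),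
    ⟨_, ⟨d, hd, rfl⟩, ?_, OpenPartialHomeomorph.refl ℝ, mem_univ _, contDiffOn_id, contDiffOn_id,
      .rfl⟩, ?_⟩
  · change (⟨x, 0 + s x⟩ : TotalSpace ℝ ν) ∈ d.1
    rwa [zero_add]
  · rw [← Function.comp_assoc, hz]
    exact ⟨h1, h2, h3⟩

theorem isHomotopy_sectionHomotopy [VectorBundle ℝ ℝ ν]
    (ξ : GammaStructure (𝓡 n) r ν) {s : ∀ x, ν x}
    (hs : ContMDiff (𝓡 n) ((𝓡 n).prod 𝓘(ℝ, ℝ)) r (fun x => (⟨x, s x⟩ : TotalSpace ℝ ν)))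
    (hdom : ∀ x, (⟨x, s x⟩ : TotalSpace ℝ ν) ∈ ξ.domain)
    (hdom' : ∀ x (t : unitInterval), (⟨x, (t : ℝ) • s x⟩ : TotalSpace ℝ ν) ∈ ξ.domain) :
    (ξ.sectionHomotopy s hs hdom').IsHomotopy ξ (ξ.pullbackSection s hs hdom) := by
  constructor
  · rintro x _ ⟨_, ⟨c, hc, rfl⟩, rfl⟩ d hd hxc hxd
    have hΦ : (fun p : TotalSpace ℝ ν =>
        (⟨p.proj, p.2 + ((0 : unitInterval) : ℝ) • s p.proj⟩ : TotalSpace ℝ ν)) = id := by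
      funext p; simp
    change zeroSection ℝ ν x ∈ ((fun p : TotalSpace ℝ ν =>
        (⟨p.proj, p.2 + ((0 : unitInterval) : ℝ) • s p.proj⟩ : TotalSpace ℝ ν)) ⁻¹' c.1) at hxc
    change GermRelated r (c.2 ∘ fun p : TotalSpace ℝ ν =>
        (⟨p.proj, p.2 + ((0 : unitInterval) : ℝ) • s p.proj⟩ : TotalSpace ℝ ν)) d.2 _
    rw [hΦ] at hxc ⊢
    exact ξ.compatible c hc d hd _ ⟨hxc, hxd⟩
  · rintro x _ ⟨_, ⟨c, hc, rfl⟩, rfl⟩ _ ⟨d, hd, rfl⟩ hxc hxd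
    have hΦ : (fun p : TotalSpace ℝ ν =>
        (⟨p.proj, p.2 + ((1 : unitInterval) : ℝ) • s p.proj⟩ : TotalSpace ℝ ν)) =
        fun p => ⟨p.proj, p.2 + s p.proj⟩ := by
      funext p; simp
    change zeroSection ℝ ν x ∈ ((fun p : TotalSpace ℝ ν =>
        (⟨p.proj, p.2 + ((1 : unitInterval) : ℝ) • s p.proj⟩ : TotalSpace ℝ ν)) ⁻¹' c.1) at hxc
    change GermRelated r (c.2 ∘ fun p : TotalSpace ℝ ν =>
        (⟨p.proj, p.2 + ((1 : unitInterval) : ℝ) • s p.proj⟩ : TotalSpace ℝ ν)) _ _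
    rw [hΦ] at hxc ⊢
    exact (ξ.pullbackSection s hs hdom).compatible _ ⟨c, hc, rfl⟩ _ ⟨d, hd, rfl⟩ _ ⟨hxc, hxd⟩

end GammaStructure

end Contacts

/-! ### The inductive step over one foliated box. -/

section Step

variable {n : ℕ} {M : Type*} [TopologicalSpace M] [ChartedSpace (EuclideanSpace ℝ (Fin n)) M]
  {ν : M → Type*} [∀ x, AddCommGroup (ν x)] [∀ x, Module ℝ (ν x)]
  [TopologicalSpace (TotalSpace ℝ ν)] [∀ x, TopologicalSpace (ν x)] [FiberBundle ℝ ν]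
  {r : ℕ∞} {ξ : GammaStructure (𝓡 n) r ν} {N : Set (TotalSpace ℝ ν)} {x₀ : M}

namespace FoliatedBox

/-- The box as a subset of the total space. -/
def box (b : FoliatedBox ξ N x₀) : Set (TotalSpace ℝ ν) :=
  (totalChart n ν x₀).source ∩ totalChart n ν x₀ ⁻¹' b.Φ.source

/-- The closed ball of the base with the same centre and `θ` times the radius. -/
def core (b : FoliatedBox ξ N x₀) (θ : ℝ) : Set M :=
  (extChartAt (𝓡 n) x₀).symm '' Metric.closedBall (extChartAt (𝓡 n) x₀ x₀) (θ * b.ρ)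

variable (b : FoliatedBox ξ N x₀)

theorem isOpen_box : IsOpen b.box :=
  (continuousOn_extChartAt _).isOpen_inter_preimage (isOpen_extChartAt_source _) b.Φ.open_source

theorem ball_subset_target :
    Metric.ball (extChartAt (𝓡 n) x₀ x₀) b.ρ ⊆ (extChartAt (𝓡 n) x₀).target := fun z hz =>
  (mem_totalChart_target.1 (b.source_subset (a := (z, 0))
    (by rw [b.source_eq]; exact ⟨hz, Metric.mem_ball_self b.ρ_pos⟩))).1

theorem closedBall_subset_ball {θ : ℝ} (hθ : θ < 1) :
    Metric.closedBall (extChartAt (𝓡 n) x₀ x₀) (θ * b.ρ) ⊆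
      Metric.ball (extChartAt (𝓡 n) x₀ x₀) b.ρ :=
  Metric.closedBall_subset_ball (by nlinarith [b.ρ_pos])

theorem isCompact_core {θ : ℝ} (hθ : θ < 1) : IsCompact (b.core θ) :=
  (isCompact_closedBall _ _).image_of_continuousOn ((continuousOn_extChartAt_symm x₀).mono
    ((b.closedBall_subset_ball hθ).trans b.ball_subset_target))

theorem core_mem_nhds {θ : ℝ} (hθ : 0 < θ) : b.core θ ∈ 𝓝 x₀ := by
  have h : Metric.closedBall (extChartAt (𝓡 n) x₀ x₀) (θ * b.ρ) ∈ 𝓝 (extChartAt (𝓡 n) x₀ x₀) :=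
    Metric.closedBall_mem_nhds _ (mul_pos hθ b.ρ_pos)
  filter_upwards [(continuousAt_extChartAt (I := 𝓡 n) x₀).eventually h,
    extChartAt_source_mem_nhds (I := 𝓡 n) x₀] with x hx hxs
  exact ⟨_, hx, (extChartAt (𝓡 n) x₀).left_inv hxs⟩

theorem box_subset : b.box ⊆ N := fun p hp => by
  have := (b.symm_mem _ hp.2).1
  rwa [(totalChart n ν x₀).left_inv hp.1] at this

theorem box_subset_chart : b.box ⊆ b.c.1 := fun p hp => by
  have := (b.symm_mem _ hp.2).2
  rwa [(totalChart n ν x₀).left_inv hp.1] at this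

variable [VectorBundle ℝ ℝ ν]

theorem zeroSection_mem_box {θ : ℝ} (hθ : θ < 1) {x : M} (hx : x ∈ b.core θ) :
    zeroSection ℝ ν x ∈ b.box := by
  obtain ⟨z, hz, rfl⟩ := hx
  have hzb := b.closedBall_subset_ball hθ hz
  have hzΦ : (z, (0 : ℝ)) ∈ b.Φ.source := by
    rw [b.source_eq]; exact ⟨hzb, Metric.mem_ball_self b.ρ_pos⟩
  have hbase := (mem_totalChart_target.1 (b.source_subset hzΦ)).2
  have hzt := b.ball_subset_target hzb
  have hsrc : zeroSection ℝ ν ((extChartAt (𝓡 n) x₀).symm z) ∈ (totalChart n ν x₀).source :=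
    mem_totalChart_source.2 ⟨(extChartAt (𝓡 n) x₀).map_target hzt, hbase⟩
  refine ⟨hsrc, ?_⟩
  rw [mem_preimage, totalChart_apply, Trivialization.zeroSection ℝ _ hbase,
    (extChartAt (𝓡 n) x₀).right_inv hzt]
  exact hzΦ

/-- The fibre factor of the box is a ball centred at `0`. This keeps the homotopy `t s` inside the
box. -/
theorem smul_mem_box {p : TotalSpace ℝ ν} (hp : p ∈ b.box) (t : unitInterval) :
    (⟨p.proj, (t : ℝ) • p.2⟩ : TotalSpace ℝ ν) ∈ b.box := by
  refine ⟨mem_totalChart_source.2 ⟨(mem_totalChart_source.1 hp.1).1,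
    (mem_totalChart_source.1 hp.1).2⟩, ?_⟩
  have h := hp.2
  rw [mem_preimage, b.source_eq] at h
  rw [mem_preimage, totalChart_smul hp.1, b.source_eq]
  refine ⟨h.1, ?_⟩
  have h2 := h.2
  rw [mem_ball_zero_iff, Real.norm_eq_abs] at h2 ⊢
  rw [abs_mul, abs_of_nonneg t.2.1]
  exact (mul_le_of_le_one_left (abs_nonneg _) t.2.2).trans_lt h2

end FoliatedBox

variable [IsManifold (𝓡 n) ∞ M]

theorem tendsto_extChartAt_symm_nhdsNE {z : EuclideanSpace ℝ (Fin n)}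
    (hz : z ∈ (extChartAt (𝓡 n) x₀).target) :
    Tendsto (extChartAt (𝓡 n) x₀).symm (𝓝[≠] z) (𝓝[≠] ((extChartAt (𝓡 n) x₀).symm z)) := by
  refine tendsto_nhdsWithin_iff.2 ⟨(contMDiffAt_extChartAt_symm_of_mem
    (r := 0) hz).continuousAt.tendsto.mono_left nhdsWithin_le_nhds, ?_⟩
  filter_upwards [self_mem_nhdsWithin, mem_nhdsWithin_of_mem_nhds
    ((isOpen_extChartAt_target x₀).mem_nhds hz)] with y hy hyt h
  exact hy ((extChartAt (𝓡 n) x₀).symm.injOn hyt hz h)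

theorem tendsto_extChartAt_nhdsNE {x : M} (hx : x ∈ (extChartAt (𝓡 n) x₀).source) :
    Tendsto (extChartAt (𝓡 n) x₀) (𝓝[≠] x) (𝓝[≠] (extChartAt (𝓡 n) x₀ x)) := by
  refine tendsto_nhdsWithin_iff.2 ⟨(contMDiffAt_extChartAt_of_mem
    (r := 0) hx).continuousAt.tendsto.mono_left nhdsWithin_le_nhds, ?_⟩
  filter_upwards [self_mem_nhdsWithin, mem_nhdsWithin_of_mem_nhds
    ((isOpen_extChartAt_source x₀).mem_nhds hx)] with y hy hys h
  exact hy ((extChartAt (𝓡 n) x₀).injOn hys hx h)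

namespace GammaStructure

theorem isContact_iff_fderiv (hr : 1 ≤ r) {s : ∀ x, ν x}
    (hs : ContMDiff (𝓡 n) ((𝓡 n).prod 𝓘(ℝ, ℝ)) r (fun x => (⟨x, s x⟩ : TotalSpace ℝ ν)))
    {c : Set (TotalSpace ℝ ν) × (TotalSpace ℝ ν → ℝ)} (hc : c ∈ ξ.charts) {x : M}
    (hx : (⟨x, s x⟩ : TotalSpace ℝ ν) ∈ c.1) (hx₀ : x ∈ (extChartAt (𝓡 n) x₀).source) :
    ξ.IsContact s x ↔ fderiv ℝ ((c.2 ∘ fun x => (⟨x, s x⟩ : TotalSpace ℝ ν)) ∘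
      (extChartAt (𝓡 n) x₀).symm) (extChartAt (𝓡 n) x₀ x) = 0 := by
  have hr0 := coe_ne_zero_of_one_le hr
  rw [isContact_iff hr hs hc hx, mfderiv_eq_zero_iff_fderiv_comp_symm hx₀
    ((ξ.contMDiffAt_chart_comp hs hc hx).mdifferentiableAt hr0)]

theorem quadratic_and_isolated_of_hessian (hr : 1 ≤ r) {s : ∀ x, ν x}
    (hs : ContMDiff (𝓡 n) ((𝓡 n).prod 𝓘(ℝ, ℝ)) r (fun x => (⟨x, s x⟩ : TotalSpace ℝ ν)))
    {c : Set (TotalSpace ℝ ν) × (TotalSpace ℝ ν → ℝ)} (hc : c ∈ ξ.charts) {x : M}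
    (hx : (⟨x, s x⟩ : TotalSpace ℝ ν) ∈ c.1) (hx₀ : x ∈ (extChartAt (𝓡 n) x₀).source)
    (h : ξ.IsContact s x)
    (h2 : ContDiffAt ℝ 2 ((c.2 ∘ fun x => (⟨x, s x⟩ : TotalSpace ℝ ν)) ∘
      (extChartAt (𝓡 n) x₀).symm) (extChartAt (𝓡 n) x₀ x))
    (hH : NondegenerateHessian ((c.2 ∘ fun x => (⟨x, s x⟩ : TotalSpace ℝ ν)) ∘
      (extChartAt (𝓡 n) x₀).symm) (extChartAt (𝓡 n) x₀ x)) :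
    ξ.IsQuadraticContact s x ∧ ∀ᶠ y in 𝓝[≠] x, ¬ ξ.IsContact s y := by
  have h0 := (isContact_iff_fderiv hr hs hc hx hx₀).1 h
  have hf : ContMDiffAt (𝓡 n) 𝓘(ℝ, ℝ) 2 (c.2 ∘ fun x => (⟨x, s x⟩ : TotalSpace ℝ ν)) x :=
    ((h2.contMDiffAt.comp x (contMDiffAt_extChartAt_of_mem (r := 2) hx₀))).congr_of_eventuallyEq
      (comp_extChartAt_symm_comp_extChartAt_eventuallyEq _ hx₀).symm
  refine ⟨⟨c, hc, hx, hf, ?_, hH.change_chart hx₀ hf h0⟩, ?_⟩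
  · exact (isContact_iff_fderiv hr hs hc hx (mem_extChartAt_source x)).1 h
  · filter_upwards [(tendsto_extChartAt_nhdsNE hx₀).eventually (hH.eventually_fderiv_ne_zero h2),
      mem_nhdsWithin_of_mem_nhds ((isOpen_extChartAt_source x₀).mem_nhds hx₀),
      mem_nhdsWithin_of_mem_nhds (hs.continuous.continuousAt.preimage_mem_nhds
        ((ξ.isOpen_chart c hc).mem_nhds hx))] with y hy hys hyc hcon
    exact hy ((isContact_iff_fderiv hr hs hc hyc hys).1 hcon)

variable [VectorBundle ℝ ℝ ν] [ContMDiffVectorBundle ∞ ℝ ν (𝓡 n)]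

/-- The section is rewritten as a graph in foliated coordinates and `exists_local_perturbation` is
applied. The three radii play different roles: over `3/4` membership in `𝒩` forces the section into
the box, within `1/2` it is modified, and on `1/4` all its contacts become good. -/
theorem exists_isMorseOn_union [T2Space M] (hr : 1 ≤ r) (b : FoliatedBox ξ N x₀)
    {𝒩 : Set (TotalSpace ℝ ν)} (h𝒩 : IsOpen 𝒩)
    (h𝒩b : ∀ p ∈ 𝒩, p.proj ∈ b.core (3 / 4) → p ∈ b.box) {s : ∀ x, ν x}
    (hs : ContMDiff (𝓡 n) ((𝓡 n).prod 𝓘(ℝ, ℝ)) r (fun x => (⟨x, s x⟩ : TotalSpace ℝ ν)))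
    (hs𝒩 : ∀ x, (⟨x, s x⟩ : TotalSpace ℝ ν) ∈ 𝒩) {A : Set M} (hA : IsClosed A)
    (hsA : ξ.IsMorseOn s A) :
    ∃ s' : ∀ x, ν x,
      ContMDiff (𝓡 n) ((𝓡 n).prod 𝓘(ℝ, ℝ)) r (fun x => (⟨x, s' x⟩ : TotalSpace ℝ ν)) ∧
      (∀ x, (⟨x, s' x⟩ : TotalSpace ℝ ν) ∈ 𝒩) ∧ ξ.IsMorseOn s' (A ∪ b.core (1 / 4)) := by
  set φ := extChartAt (𝓡 n) x₀
  set T := totalChart n ν x₀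
  set σ : M → TotalSpace ℝ ν := fun x => ⟨x, s x⟩ with hσ
  set U := Metric.ball (φ x₀) (3 / 4 * b.ρ)
  set U₁ := Metric.ball (φ x₀) (1 / 2 * b.ρ)
  have hρ := b.ρ_pos
  have hUt : U ⊆ φ.target := (Metric.ball_subset_closedBall.trans
    (b.closedBall_subset_ball (by norm_num))).trans b.ball_subset_target
  have hU₁U : U₁ ⊆ U := Metric.ball_subset_ball (by nlinarith)
  have hKU₁ : Metric.closedBall (φ x₀) (1 / 4 * b.ρ) ⊆ U₁ :=
    Metric.closedBall_subset_ball (by nlinarith)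
  have hcU : Metric.closedBall (φ x₀) (1 / 2 * b.ρ) ⊆ U :=
    Metric.closedBall_subset_ball (by nlinarith)
  have hsrc : ∀ z ∈ U, φ.symm z ∈ φ.source := fun z hz => φ.map_target (hUt hz)
  have hri : ∀ z ∈ U, φ (φ.symm z) = z := fun z hz => φ.right_inv (hUt hz)
  have hbox : ∀ (p : TotalSpace ℝ ν) (z), z ∈ U → p.proj = φ.symm z → p ∈ 𝒩 → p ∈ b.box :=
    fun p z hz hp h => h𝒩b p h (hp ▸ mem_image_of_mem _ (Metric.ball_subset_closedBall hz))
  have hTfst : ∀ p ∈ b.box, (T p).1 = φ p.proj := fun p hp => by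
    rw [totalChart_apply_of_mem hp.1]
  have hΦT : ∀ p ∈ b.box, b.Φ (T p) = (φ p.proj, b.c.2 p) := fun p hp => by
    rw [b.Φ_apply _ hp.2, hTfst p hp, T.left_inv hp.1]
  have hΦs : ∀ p ∈ b.box, b.Φ.symm (φ p.proj, b.c.2 p) = T p := fun p hp => by
    rw [← hΦT p hp, b.Φ.left_inv hp.2]
  set g : EuclideanSpace ℝ (Fin n) → ℝ := (b.c.2 ∘ σ) ∘ φ.symm
  have hσb : ∀ z ∈ U, σ (φ.symm z) ∈ b.box := fun z hz => hbox _ z hz rfl (hs𝒩 _)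
  have hg : ContDiffOn ℝ r g U := fun z hz => ContDiffAt.contDiffWithinAt <|
    ((ξ.contMDiffAt_chart_comp hs b.c_mem (b.box_subset_chart (hσb z hz))).comp z
      (contMDiffAt_extChartAt_symm_of_mem (hUt hz))).contDiffAt
  -- `O` is the constraint `𝒩` read in foliated coordinates; preserving it keeps the section in
  -- every other box of the cover as well.
  set O := b.Φ.target ∩ b.Φ.symm ⁻¹' (T.target ∩ T.symm ⁻¹' 𝒩)
  have hO : IsOpen O := b.Φ.symm.continuousOn.isOpen_inter_preimage b.Φ.open_target
    ((continuousOn_extChartAt_symm _).isOpen_inter_preimage (isOpen_extChartAt_target _) h𝒩)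
  have hgΦ : ∀ z ∈ U, b.Φ.symm (z, g z) = T (σ (φ.symm z)) := fun z hz => by
    have := hΦs _ (hσb z hz)
    rwa [show φ (σ (φ.symm z)).proj = z from hri z hz] at this
  have hgO : ∀ z ∈ U, (z, g z) ∈ O := fun z hz => by
    refine ⟨?_, ?_⟩
    · have := b.Φ.map_source (hσb z hz).2
      rw [hΦT _ (hσb z hz)] at this
      rwa [show φ (σ (φ.symm z)).proj = z from hri z hz] at this
    · rw [mem_preimage, hgΦ z hz]
      refine ⟨T.map_source (hσb z hz).1, ?_⟩
      rw [mem_preimage, T.left_inv (hσb z hz).1]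
      exact hs𝒩 _
  set B := Metric.closedBall (φ x₀) (1 / 2 * b.ρ) ∩ φ.symm ⁻¹' A
  have hB : IsCompact B := (isCompact_closedBall _ _).of_isClosed_subset
    (((continuousOn_extChartAt_symm x₀).mono (hcU.trans hUt)).preimage_isClosed_of_isClosed
      Metric.isClosed_closedBall hA) inter_subset_left
  have hcon : ∀ z ∈ U, ξ.IsContact s (φ.symm z) ↔ fderiv ℝ g z = 0 := fun z hz => by
    rw [isContact_iff_fderiv hr hs b.c_mem (b.box_subset_chart (hσb z hz)) (hsrc z hz)]
    rw [show extChartAt (𝓡 n) x₀ (φ.symm z) = z from hri z hz]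
  -- Isolation of contacts does not depend on the distinguished function, so it passes to this box
  -- even when the quadratic contact was seen in another one.
  have hiso : ∀ z ∈ B, fderiv ℝ g z = 0 → ∀ᶠ y in 𝓝[≠] z, fderiv ℝ g y ≠ 0 := fun z hz h0 => by
    have hzU := hcU hz.1
    filter_upwards [(tendsto_extChartAt_symm_nhdsNE (hUt hzU)).eventually
      (hsA _ hz.2 ((hcon z hzU).2 h0)).2, mem_nhdsWithin_of_mem_nhds
      (Metric.isOpen_ball.mem_nhds hzU)] with y hy hyU h
    exact hy ((hcon y hyU).2 h)
  obtain ⟨g', L, hL, hLU₁, hoff, hg'U, hg'O, hg'B, hg'K⟩ := exists_local_perturbation hr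
    Metric.isOpen_ball hg (isCompact_closedBall _ _) hKU₁ Metric.isOpen_ball hU₁U hB
    (inter_subset_left.trans hcU) hiso hO hgO
  have hLU := hLU₁.trans hU₁U
  set L' := φ.symm '' L
  have hL' : IsClosed L' := (hL.image_of_continuousOn
    ((continuousOn_extChartAt_symm x₀).mono (hLU.trans hUt))).isClosed
  have hmemL : ∀ z ∈ U, φ.symm z ∈ L' → z ∈ L := by
    rintro z hz ⟨y, hy, hyz⟩
    rwa [φ.symm.injOn (hUt hz) (hUt (hLU hy)) hyz.symm]
  classical
  -- The section changes only over the closed set `L'`, so it agrees with `s` on an open set. Over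
  -- all of `U` it is the graph of `g'`, which gives regularity across the boundary of `L'`.
  set s' : ∀ x, ν x := fun x => if x ∈ L' then
    (trivializationAt ℝ ν x₀).symm x (b.Φ.symm (φ x, g' (φ x))).2 else s x with hs'def
  have hs'off : ∀ x ∉ L', ∀ᶠ y in 𝓝 x, s' y = s y := fun x hx => by
    filter_upwards [hL'.isOpen_compl.mem_nhds hx] with y hy
    exact if_neg hy
  have hw1 : ∀ z ∈ U, (b.Φ.symm (z, g' z)).1 = z := fun z hz => by
    have h1 := b.Φ_apply _ (b.Φ.map_target (hg'O z hz).1)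
    rw [b.Φ.right_inv (hg'O z hz).1] at h1
    exact (congrArg Prod.fst h1).symm
  have hσ' : ∀ z ∈ U, (⟨φ.symm z, s' (φ.symm z)⟩ : TotalSpace ℝ ν) =
      T.symm (b.Φ.symm (z, g' z)) := fun z hz => by
    by_cases hzL : φ.symm z ∈ L'
    · rw [totalChart_symm_apply (hg'O z hz).2.1, hw1 z hz]
      simp only [hs'def, if_pos hzL]
      rw [hri z hz]
    · have hzL' : z ∉ L := fun h => hzL (mem_image_of_mem _ h)
      rw [hoff z hzL', hgΦ z hz, T.left_inv (hσb z hz).1]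
      simp only [hs'def, if_neg hzL, hσ]
  have hσ'𝒩U : ∀ z ∈ U, (⟨φ.symm z, s' (φ.symm z)⟩ : TotalSpace ℝ ν) ∈ 𝒩 := fun z hz => by
    rw [hσ' z hz]; exact (hg'O z hz).2.2
  have hσ'b : ∀ z ∈ U, (⟨φ.symm z, s' (φ.symm z)⟩ : TotalSpace ℝ ν) ∈ b.box := fun z hz =>
    hbox _ z hz rfl (hσ'𝒩U z hz)
  have hcg' : ∀ z ∈ U, b.c.2 ⟨φ.symm z, s' (φ.symm z)⟩ = g' z := fun z hz => by
    have h1 := b.Φ_apply _ (b.Φ.map_target (hg'O z hz).1)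
    rw [b.Φ.right_inv (hg'O z hz).1] at h1
    rw [hσ' z hz]
    exact (congrArg Prod.snd h1).symm
  have hg'e : ∀ z ∈ U, (b.c.2 ∘ fun x => (⟨x, s' x⟩ : TotalSpace ℝ ν)) ∘ φ.symm =ᶠ[𝓝 z] g' :=
    fun z hz => by
      filter_upwards [Metric.isOpen_ball.mem_nhds hz] with y hy using hcg' y hy
  have hs' : ContMDiff (𝓡 n) ((𝓡 n).prod 𝓘(ℝ, ℝ)) r
      (fun x => (⟨x, s' x⟩ : TotalSpace ℝ ν)) := by
    intro x
    by_cases hx : x ∈ L'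
    · obtain ⟨z, hz, rfl⟩ := hx
      have hzU := hLU hz
      have h1 : ContMDiffAt (𝓡 n) 𝓘(ℝ, EuclideanSpace ℝ (Fin n)) r φ (φ.symm z) :=
        contMDiffAt_extChartAt_of_mem (hsrc z hzU)
      have h2 : ContDiffAt ℝ r (fun z => b.Φ.symm (z, g' z)) z :=
        ContDiffAt.comp z (b.contDiffOn_symm.contDiffAt (b.Φ.open_target.mem_nhds (hg'O z hzU).1))
          (contDiffAt_id.prodMk (hg'U.contDiffAt (Metric.isOpen_ball.mem_nhds hzU)))
      have h3 : ContMDiffAt 𝓘(ℝ, EuclideanSpace ℝ (Fin n) × ℝ) ((𝓡 n).prod 𝓘(ℝ, ℝ)) r T.symm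
          (b.Φ.symm (z, g' z)) :=
        ((contMDiffOn_extChartAt_symm (n := ∞) _).contMDiffAt
          ((isOpen_extChartAt_target _).mem_nhds (hg'O z hzU).2.1)).of_le
          (by exact_mod_cast le_top)
      have h4 : ContMDiffAt 𝓘(ℝ, EuclideanSpace ℝ (Fin n)) ((𝓡 n).prod 𝓘(ℝ, ℝ)) r
          (T.symm ∘ fun z => b.Φ.symm (z, g' z)) (φ (φ.symm z)) := by
        rw [hri z hzU]
        exact h3.comp z h2.contMDiffAt
      refine (h4.comp _ h1).congr_of_eventuallyEq ?_
      filter_upwards [(isOpen_extChartAt_source x₀).mem_nhds (hsrc z hzU),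
        h1.continuousAt.preimage_mem_nhds
          (Metric.isOpen_ball.mem_nhds (show φ (φ.symm z) ∈ U by rwa [hri z hzU]))] with y hy hyU
      have := hσ' _ hyU
      rwa [φ.left_inv hy] at this
    · refine (hs x).congr_of_eventuallyEq ?_
      filter_upwards [hs'off x hx] with y hy
      rw [hy]
  have hcon' : ∀ z ∈ U, ξ.IsContact s' (φ.symm z) ↔ fderiv ℝ g' z = 0 := fun z hz => by
    rw [isContact_iff_fderiv hr hs' b.c_mem (b.box_subset_chart (hσ'b z hz)) (hsrc z hz)]
    rw [show extChartAt (𝓡 n) x₀ (φ.symm z) = z from hri z hz, (hg'e z hz).fderiv_eq]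
  -- Off `L'` the two sections have the same germ, and both quadratic contact and isolation depend
  -- only on that germ.
  have hold : ∀ x ∈ A, x ∉ L' → ξ.IsContact s' x →
      ξ.IsQuadraticContact s' x ∧ ∀ᶠ y in 𝓝[≠] x, ¬ ξ.IsContact s' y := fun x hxA hxL hc => by
    have he := hs'off x hxL
    obtain ⟨h1, h2⟩ := hsA x hxA ((isContact_congr he).1 hc)
    refine ⟨h1.congr he, ?_⟩
    filter_upwards [h2, he.eventually_nhds.filter_mono nhdsWithin_le_nhds] with y hy hye
    rwa [isContact_congr hye]
  refine ⟨s', hs', fun x => ?_, ?_⟩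
  · by_cases hx : x ∈ L'
    · obtain ⟨z, hz, rfl⟩ := hx
      exact hσ'𝒩U z (hLU hz)
    · simp only [hs'def, if_neg hx]; exact hs𝒩 x
  · rintro x (hxA | ⟨z, hzK, rfl⟩) hc
    · by_cases hx : x ∈ L'
      · obtain ⟨z, hz, rfl⟩ := hx
        exact absurd ((hcon' z (hLU hz)).1 hc)
          (hg'B z ⟨⟨Metric.ball_subset_closedBall (hLU₁ hz), hxA⟩, hz⟩)
      · exact hold x hxA hx hc
    · have hzU := hU₁U (hKU₁ hzK)
      rcases hg'K z hzK ((hcon' z hzU).1 hc) with ⟨hzB, hzL⟩ | ⟨hd, hH⟩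
      · exact hold _ hzB.2 (fun h => hzL (hmemL z hzU h)) hc
      · refine quadratic_and_isolated_of_hessian hr hs' b.c_mem
          (b.box_subset_chart (hσ'b z hzU)) (hsrc z hzU) hc ?_ ?_
        · rw [show extChartAt (𝓡 n) x₀ (φ.symm z) = z from hri z hzU]
          exact (hd.of_le (by norm_cast)).congr_of_eventuallyEq (hg'e z hzU)
        · rw [show extChartAt (𝓡 n) x₀ (φ.symm z) = z from hri z hzU, NondegenerateHessian,
            (hg'e z hzU).fderiv.fderiv_eq]
          exact hH

end GammaStructure

end Step

/-! ### Globalization over a finite cover. -/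

theorem mainTheorem7 {n : ℕ} {M : Type*} [TopologicalSpace M] [T2Space M] [CompactSpace M]
    [ChartedSpace (EuclideanSpace ℝ (Fin n)) M] [IsManifold (𝓡 n) ∞ M]
    {ν : M → Type*} [∀ x, AddCommGroup (ν x)] [∀ x, Module ℝ (ν x)]
    [TopologicalSpace (TotalSpace ℝ ν)] [∀ x, TopologicalSpace (ν x)] [FiberBundle ℝ ν]
    [VectorBundle ℝ ℝ ν] [ContMDiffVectorBundle ∞ ℝ ν (𝓡 n)]
    {r : ℕ∞} (hr : 1 ≤ r) (ξ : GammaStructure (𝓡 n) r ν)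
    (N : Set (TotalSpace ℝ ν)) (hN : IsOpen N) (hN0 : ∀ x, zeroSection ℝ ν x ∈ N) :
    ∃ (s : ∀ x, ν x)
      (hs : ContMDiff (𝓡 n) ((𝓡 n).prod 𝓘(ℝ, ℝ)) r (fun x => (⟨x, s x⟩ : TotalSpace ℝ ν)))
      (hdom : ∀ x, (⟨x, s x⟩ : TotalSpace ℝ ν) ∈ ξ.domain)
      (hdom' : ∀ x (t : unitInterval), (⟨x, (t : ℝ) • s x⟩ : TotalSpace ℝ ν) ∈ ξ.domain),
      (∀ x (t : unitInterval), (⟨x, (t : ℝ) • s x⟩ : TotalSpace ℝ ν) ∈ N) ∧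
      (ξ.sectionHomotopy s hs hdom').IsHomotopy ξ (ξ.pullbackSection s hs hdom) ∧
      (ξ.pullbackSection s hs hdom).IsMorse := by
  have b : ∀ x₀, FoliatedBox ξ N x₀ := fun x₀ => (ξ.nonempty_foliatedBox hr hN hN0 x₀).some
  obtain ⟨T, -, hT⟩ := isCompact_univ.elim_nhds_subcover (fun x₀ : M => (b x₀).core (1 / 4))
    fun x₀ _ => (b x₀).core_mem_nhds (by norm_num)
  -- A single open condition, fixed before the induction: over each closed `3/4`-core the value lies
  -- in the corresponding box. It contains the zero section and is open because the cores are
  -- closed.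
  set 𝒩 : Set (TotalSpace ℝ ν) :=
    ⋂ i ∈ T, ((fun p => p.proj) ⁻¹' ((b i).core (3 / 4))ᶜ ∪ (b i).box)
  have h𝒩 : IsOpen 𝒩 := isOpen_biInter_finset fun i _ =>
    ((((b i).isCompact_core (by norm_num)).isClosed.isOpen_compl).preimage
      (FiberBundle.continuous_proj ℝ ν)).union (b i).isOpen_box
  have h𝒩b : ∀ i ∈ T, ∀ p ∈ 𝒩, p.proj ∈ (b i).core (3 / 4) → p ∈ (b i).box :=
    fun i hi p hp hpi => (mem_iInter₂.1 hp i hi).resolve_left fun h => h hpi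
  -- The induction starts from the zero section with nothing treated, and adds one `1/4`-core at a
  -- time.
  have hind : ∀ S ⊆ T, ∃ s : ∀ x, ν x,
      ContMDiff (𝓡 n) ((𝓡 n).prod 𝓘(ℝ, ℝ)) r (fun x => (⟨x, s x⟩ : TotalSpace ℝ ν)) ∧
      (∀ x, (⟨x, s x⟩ : TotalSpace ℝ ν) ∈ 𝒩) ∧
      ξ.IsMorseOn s (⋃ i ∈ S, (b i).core (1 / 4)) := by
    classical
    intro S
    induction S using Finset.induction_on with
    | empty =>
      refine fun _ => ⟨fun _ => 0, contMDiff_zeroSection ℝ ν, fun x => ?_,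
        by simp [GammaStructure.IsMorseOn]⟩
      refine mem_iInter₂.2 fun i _ => ?_
      by_cases hx : x ∈ (b i).core (3 / 4)
      · exact .inr ((b i).zeroSection_mem_box (by norm_num) hx)
      · exact .inl hx
    | insert i S _ ih =>
      intro hS
      obtain ⟨s, hs, hs𝒩, hsM⟩ := ih fun j hj => hS (Finset.mem_insert_of_mem hj)
      have hcl : IsClosed (⋃ i ∈ S, (b i).core (1 / 4)) := S.finite_toSet.isClosed_biUnion
        fun i _ => ((b i).isCompact_core (by norm_num)).isClosed
      rw [Finset.set_biUnion_insert, union_comm]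
      exact GammaStructure.exists_isMorseOn_union hr (b i) h𝒩
        (h𝒩b i (hS (Finset.mem_insert_self i S))) hs hs𝒩 hcl hsM
  obtain ⟨s, hs, hs𝒩, hsM⟩ := hind T subset_rfl
  have hbox : ∀ x, ∃ i, (⟨x, s x⟩ : TotalSpace ℝ ν) ∈ (b i).box := fun x => by
    obtain ⟨i, hi, hxi⟩ := mem_iUnion₂.1 (hT (mem_univ x))
    refine ⟨i, h𝒩b i hi _ (hs𝒩 x) (image_mono (Metric.closedBall_subset_closedBall ?_) hxi)⟩
    nlinarith [(b i).ρ_pos]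
  have hchart : ∀ i, (b i).box ⊆ ξ.domain := fun i p hp => by
    rw [← ξ.sUnion_charts]
    exact mem_biUnion (b i).c_mem ((b i).box_subset_chart hp)
  have hdom' : ∀ x (t : unitInterval), (⟨x, (t : ℝ) • s x⟩ : TotalSpace ℝ ν) ∈ ξ.domain :=
    fun x t => (hbox x).elim fun i hi => hchart i ((b i).smul_mem_box hi t)
  have hdom : ∀ x, (⟨x, s x⟩ : TotalSpace ℝ ν) ∈ ξ.domain :=
    fun x => (hbox x).elim fun i hi => hchart i hi
  refine ⟨s, hs, hdom, hdom', fun x t => ?_, ξ.isHomotopy_sectionHomotopy hs hdom hdom',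
    ξ.isMorse_pullbackSection hr hs hdom fun x _ => hsM x (hT (mem_univ x))⟩
  obtain ⟨i, hi⟩ := hbox x
  exact (b i).box_subset ((b i).smul_mem_box hi t)
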